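/- Let $\mathbb{O}$ be the octonions with the standard basis $e_0=1,e_1,\dots,e_7$, and identify $\mathbb{O}^2=\mathbb{R}^{16}$ via $q_i=\sum_{a=0}^7 x_i^a e_a$, $i=1,2$. An octonionic Hermitian matrix is a matrix $A=\begin{pmatrix} a& q\\ \bar q& b\end{pmatrix}$ with $a,b\in\mathbb{R}$, $q\in\mathbb{O}$; put $\det A=ab-|q|^2$, and call $A$ positive definite if $\mathrm{Re}(\xi^*A\xi)>0$ for all $0\neq\xi\in\mathbb{O}^2$. Let $\mathcal{H}_2(\mathbb{O})$ be the space of these matrices, regarded as a space of quadratic forms on $\mathbb{R}^{16}$ via $A\mapsto \mathrm{Re}(\xi^*A\xi)$. The octonionic Hessian of a $C^2$ function $u$ on an open subset of $\mathbb{O}^2$ is $\mathrm{Hess}_{\mathbb{O}}(u)=\big(\frac{\partial^2u}{\partial\bar q_i\partial q_j}\big)_{i,j=1,2}$, where $\frac{\partial^2 u}{\partial\bar q_i\partial q_j}=\sum_{a,b=0}^7\frac{\partial^2u}{\partial x_i^a\partial x_j^b}\,e_a\bar e_b$. Let $SL_2(\mathbb{O})\subset GL_{16}(\mathbb{R})$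 be the connected subgroup whose Lie algebra is generated by the operators $\xi\mapsto A\xi$ with $A$ a traceless octonionic $2\times2$ matrix, and let $Spin(9)=SL_2(\mathbb{O})\cap O(16)$ be its maximal compact subgroup. A $Spin(9)$-manifold is a smooth manifold with an atlas of charts in $\mathbb{O}^2$ whose transition maps are, locally, compositions of an element of $Spin(9)$ with a translation; it carries the flat connection that is trivial in each of these charts. On such a manifold let $\underline{\mathcal{H}_2}(M)$ be the subbundle of $\mathrm{Sym}^2(T^*M)$ whose fibre in each chart of the atlas is $\mathcal{H}_2(\mathbb{O})$; positivity and $\det$ of its sections are well defined, and $\mathrm{Hess}_{\mathbb{O}}$, computed in the charts of the atlas, maps functions to sections of $\underline{\mathcal{H}_2}(M)$. **Theorem.** Let $M$ be a compact connected $Spin(9)$-manifold (of dimension $16$). Let $G_{00}$ be a $C^\infty$-smooth positive definite section of $\underline{\mathcal{H}_2}(M)$ that is parallel with respect to the flat connection, and let $G_0$ be another $C^\infty$-smooth positive definite section of $\underline{\mathcal{H}_2}(M)$ such that each point of $M$ has a neighbourhood in which $G_0=\mathrm{Hess}_{\mathbb{O}}(u)$ for some real $C^\infty$ function $u$. Then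 for every $K\ge 0$ there is a constant $C$, depending only on $M$, $G_{00}$, $G_0$ and $K$, with the following property: if $f\in C^2(M,\mathbb{R})$ satisfies $\|f\|_{C^2(M)}\le K$ and $\varphi\in C^4(M,\mathbb{R})$ is a solution of $$\det\big(G_0+\mathrm{Hess}_{\mathbb{O}}(\varphi)\big)=e^f\det G_0 ,$$ then $$\|\Delta\varphi\|_{C^0}\le C,\qquad\text{where}\quad \Delta\varphi=\mathrm{Re}\,\mathrm{Tr}\big(G_{00}^{-1}\,\mathrm{Hess}_{\mathbb{O}}(\varphi)\big).$$ -/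

import Mathlib

open scoped Manifold ContDiff ENNReal NNReal Matrix Topology

namespace OctMA

/-! ### Octonions -/

/-- The octonions `∑_a x_a e_a`, given by their real coordinates in the basis
`e₀ = 1, e₁, …, e₇`. -/
@[ext] structure Octonion where
  /-- The coordinates in the basis `e₀, …, e₇`. -/
  coord : Fin 8 → ℝ

namespace Octonion

/-- The real part. -/
def re (x : Octonion) : ℝ := x.coord 0

/-- The square of the norm. -/
def normSq (x : Octonion) : ℝ := ∑ a, x.coord a ^ 2

/-- The basis element `e_a`. -/
def e (a : Fin 8) : Octonion := ⟨Pi.single a 1⟩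

instance : Zero Octonion := ⟨⟨0⟩⟩
instance : One Octonion := ⟨e 0⟩
instance : Add Octonion := ⟨fun x y => ⟨x.coord + y.coord⟩⟩
instance : Neg Octonion := ⟨fun x => ⟨-x.coord⟩⟩
instance : Sub Octonion := ⟨fun x y => ⟨x.coord - y.coord⟩⟩
instance {S : Type*} [SMul S ℝ] : SMul S Octonion := ⟨fun c x => ⟨c • x.coord⟩⟩

/-- Octonionic conjugation: it changes the sign of the coordinates `1, …, 7`. -/
instance : Star Octonion := ⟨fun x => ⟨fun a => if a = 0 then x.coord a else -x.coord a⟩⟩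

/-- The coordinates of the product of two octonions. The product is determined by `e₀ = 1`, `e_i² = -1` and
`e_i e_j = - e_j e_i = e_k` for `(i,j,k)` a cyclic permutation of one of
`(1,2,4)`, `(2,3,5)`, `(3,4,6)`, `(4,5,7)`, `(5,6,1)`, `(6,7,2)`, `(7,1,3)`. -/
def mulCoord (x y : Fin 8 → ℝ) : Fin 8 → ℝ :=
    ![x 0 * y 0 - x 1 * y 1 - x 2 * y 2
        - x 3 * y 3 - x 4 * y 4 - x 5 * y 5
        - x 6 * y 6 - x 7 * y 7,
      x 0 * y 1 + x 1 * y 0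
        + (x 2 * y 4 - x 4 * y 2)
        + (x 5 * y 6 - x 6 * y 5)
        + (x 3 * y 7 - x 7 * y 3),
      x 0 * y 2 + x 2 * y 0
        + (x 4 * y 1 - x 1 * y 4)
        + (x 3 * y 5 - x 5 * y 3)
        + (x 6 * y 7 - x 7 * y 6),
      x 0 * y 3 + x 3 * y 0
        + (x 5 * y 2 - x 2 * y 5)
        + (x 4 * y 6 - x 6 * y 4)
        + (x 7 * y 1 - x 1 * y 7),
      x 0 * y 4 + x 4 * y 0
        + (x 1 * y 2 - x 2 * y 1)
        + (x 6 * y 3 - x 3 * y 6)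
        + (x 5 * y 7 - x 7 * y 5),
      x 0 * y 5 + x 5 * y 0
        + (x 2 * y 3 - x 3 * y 2)
        + (x 7 * y 4 - x 4 * y 7)
        + (x 6 * y 1 - x 1 * y 6),
      x 0 * y 6 + x 6 * y 0
        + (x 3 * y 4 - x 4 * y 3)
        + (x 1 * y 5 - x 5 * y 1)
        + (x 7 * y 2 - x 2 * y 7),
      x 0 * y 7 + x 7 * y 0
        + (x 4 * y 5 - x 5 * y 4)
        + (x 2 * y 6 - x 6 * y 2)
        + (x 1 * y 3 - x 3 * y 1)]

instance : Mul Octonion := ⟨fun p q => ⟨mulCoord p.coord q.coord⟩⟩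

theorem coord_injective : Function.Injective coord := fun _ _ => Octonion.ext

instance : AddCommGroup Octonion :=
  coord_injective.addCommGroup coord rfl (fun _ _ => rfl) (fun _ => rfl) (fun _ _ => rfl)
    (fun _ _ => rfl) (fun _ _ => rfl)

instance : Module ℝ Octonion :=
  coord_injective.module ℝ ⟨⟨coord, rfl⟩, fun _ _ => rfl⟩ (fun _ _ => rfl)

@[simp] theorem coord_zero (a : Fin 8) : (0 : Octonion).coord a = 0 := rfl
@[simp] theorem coord_add (x y : Octonion) (a : Fin 8) :
    (x + y).coord a = x.coord a + y.coord a := rfl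
@[simp] theorem coord_neg (x : Octonion) (a : Fin 8) : (-x).coord a = -x.coord a := rfl
@[simp] theorem coord_smul (c : ℝ) (x : Octonion) (a : Fin 8) :
    (c • x).coord a = c * x.coord a := rfl
@[simp] theorem coord_mul (x y : Octonion) (a : Fin 8) :
    (x * y).coord a = mulCoord x.coord y.coord a := rfl
@[simp] theorem coord_star (x : Octonion) (a : Fin 8) :
    (star x).coord a = if a = 0 then x.coord a else -x.coord a := rfl
@[simp] theorem coord_one (a : Fin 8) : (1 : Octonion).coord a = if a = 0 then 1 else 0 := by
  change (Pi.single (0 : Fin 8) (1 : ℝ) : Fin 8 → ℝ) a = _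
  simp [Pi.single_apply]

instance : NonAssocRing Octonion :=
  { (inferInstance : AddCommGroup Octonion) with
    left_distrib := fun x y z => by
      ext a; fin_cases a <;> simp [mulCoord] <;> ring
    right_distrib := fun x y z => by
      ext a; fin_cases a <;> simp [mulCoord] <;> ring
    zero_mul := fun x => by
      ext a; fin_cases a <;> simp [mulCoord]
    mul_zero := fun x => by
      ext a; fin_cases a <;> simp [mulCoord]
    one_mul := fun x => by
      ext a; fin_cases a <;> simp [mulCoord]
    mul_one := fun x => by
      ext a; fin_cases a <;> simp [mulCoord] }

instance : SMulCommClass ℝ Octonion Octonion where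
  smul_comm c x y := by
    change c • (x * y) = x * (c • y)
    ext a; fin_cases a <;> simp [mulCoord] <;> ring

end Octonion

/-- The octonionic plane `𝕆² = ℝ¹⁶` with its standard Euclidean structure: the coordinate `(i, a)` is
the real coordinate `x_i^a` of the `i`-th octonionic coordinate `q_i = ∑_a x_i^a e_a`. -/
abbrev O2 : Type := EuclideanSpace ℝ (Fin 2 × Fin 8)

/-- The column `(q_1, q_2)` of the octonionic coordinates of a point of `𝕆²`. -/
def O2.col (ξ : O2) : Fin 2 → Octonion := fun i => ⟨fun a => ξ (i, a)⟩

/-- The point of `𝕆²` with given octonionic coordinates. -/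
def O2.ofCol (q : Fin 2 → Octonion) : O2 := WithLp.toLp 2 fun p => (q p.1).coord p.2

/-- `2 × 2` matrices with octonionic entries. -/
abbrev Mat2 : Type := Matrix (Fin 2) (Fin 2) Octonion

/-! ### Octonionic Hermitian `2 × 2` matrices -/

/-- The real quadratic form `ξ ↦ Re(ξ* A ξ)` on `𝕆² = ℝ¹⁶`. -/
def quadForm (A : Mat2) (ξ : O2) : ℝ := (star ξ.col ⬝ᵥ (A *ᵥ ξ.col)).re

/-- `Re(ξ* A ξ) > 0` for all `ξ ≠ 0`. -/
def PosDef (A : Mat2) : Prop := ∀ ξ : O2, ξ ≠ 0 → 0 < quadForm A ξ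

/-- The determinant `ab - |q|²` of the Hermitian matrix with rows `(a, q)`, `(q̄, b)`. -/
def hdet (A : Mat2) : ℝ := (A 0 0).re * (A 1 1).re - (A 0 1).normSq

/-- The inverse of a Hermitian matrix of non-zero determinant. -/
noncomputable def hinv (A : Mat2) : Mat2 :=
  (hdet A)⁻¹ • !![A 1 1, -A 0 1; -A 1 0, A 0 0]

/-- The real part of the trace. -/
def reTr (A : Mat2) : ℝ := A.trace.re

/-! ### The octonionic Hessian -/

/-- The partial derivative `∂f/∂x_i^a`. -/
noncomputable def partialD (i : Fin 2) (a : Fin 8) (f : O2 → ℝ) (y : O2) : ℝ :=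
  fderiv ℝ f y (EuclideanSpace.single (i, a) 1)

/-- The octonionic Hessian of a real valued function, with entries
`∂²f / ∂q̄_i ∂q_j = ∑_{a,b} (∂²f / ∂x_i^a ∂x_j^b) e_a ē_b`, where
`∂F/∂q̄_i = ∑_a e_a (∂F/∂x_i^a)` and `∂F/∂q_j = ∑_b (∂F/∂x_j^b) ē_b`. -/
noncomputable def hessO (f : O2 → ℝ) (y : O2) : Mat2 :=
  Matrix.of fun i j => ∑ a : Fin 8, ∑ b : Fin 8,
    partialD i a (partialD j b f) y • (Octonion.e a * star (Octonion.e b))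

/-! ### The groups `SL₂(𝕆)` and `Spin(9)` -/

/-- The operator `ξ ↦ A ξ` on `𝕆²`. -/
noncomputable def leftMul (A : Mat2) : O2 →L[ℝ] O2 :=
  LinearMap.toContinuousLinearMap
    { toFun := fun ξ => O2.ofCol (A *ᵥ ξ.col)
      map_add' := fun ξ η => by
        have h : (ξ + η).col = ξ.col + η.col := rfl
        rw [h, Matrix.mulVec_add]
        rfl
      map_smul' := fun c ξ => by
        have h : (c • ξ).col = c • ξ.col := rfl
        rw [h, Matrix.mulVec_smul]
        rfl }

/-- The Lie algebra `𝔰𝔩₂(𝕆)`: the Lie subalgebra of `𝔤𝔩₁₆(ℝ)` generated by the operators of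
multiplication by traceless octonionic matrices, that is, the smallest linear subspace that contains
these operators and is closed under commutators. -/
def sl2O : Submodule ℝ (O2 →L[ℝ] O2) :=
  sInf {W | (∀ A : Mat2, A.trace = 0 → leftMul A ∈ W) ∧
    ∀ X ∈ W, ∀ Y ∈ W, X * Y - Y * X ∈ W}

/-- `SL₂(𝕆)`: the connected subgroup of `GL₁₆(ℝ)` with Lie algebra `𝔰𝔩₂(𝕆)`, that is, the group
generated by the exponentials of the elements of `𝔰𝔩₂(𝕆)`. -/
def SL2O : Subgroup (O2 ≃L[ℝ] O2) :=
  Subgroup.closure {g | ∃ X ∈ sl2O, (g : O2 →L[ℝ] O2) = NormedSpace.exp X}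

/-- `Spin(9)`: the maximal compact subgroup `SL₂(𝕆) ∩ O(16)` of `SL₂(𝕆)`. -/
def Spin9 : Subgroup (O2 ≃L[ℝ] O2) where
  carrier := {g | g ∈ SL2O ∧ ∀ ξ, ‖g ξ‖ = ‖ξ‖}
  mul_mem' := fun {g h} hg hh =>
    ⟨SL2O.mul_mem hg.1 hh.1, fun ξ => (hg.2 (h ξ)).trans (hh.2 ξ)⟩
  one_mem' := ⟨SL2O.one_mem, fun _ => rfl⟩
  inv_mem' := fun {g} hg => ⟨SL2O.inv_mem hg.1, fun ξ => by
    rw [← hg.2 (g⁻¹ ξ)]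
    exact congrArg norm (g.apply_symm_apply ξ)⟩

/-! ### `G`-affine manifolds -/

variable {M : Type*} [TopologicalSpace M] [ChartedSpace O2 M]

/-- The given atlas of `M` is `G`-affine: each transition map is, locally, the composition of a
transformation from `G` and a translation. -/
def IsGAffine (G : Subgroup (O2 ≃L[ℝ] O2)) (M : Type*) [TopologicalSpace M]
    [ChartedSpace O2 M] : Prop :=
  ∀ e ∈ atlas O2 M, ∀ e' ∈ atlas O2 M, ∀ x ∈ e.source ∩ e'.source,
    ∃ g ∈ G, ∃ v : O2, ∀ᶠ y in 𝓝 (e x), e' (e.symm y) = g y + v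

/-- A (set-theoretic) section of the bundle of octonionic Hermitian matrices: a Hermitian matrix
`val e x` for each point `x` of each chart `e`, so that the values in two charts correspond to each
other under the action of the differential `D` of the transition map on Hermitian matrices.
That action is the one induced, through the embedding `A ↦ Re(ξ* A ξ)`, by the action of `D` on
quadratic forms; so the condition says that the quadratic form on the tangent space does not depend
on the chart. -/
structure HermSection (M : Type*) [TopologicalSpace M] [ChartedSpace O2 M] where
  val : OpenPartialHomeomorph M O2 → M → Mat2
  isHermitian : ∀ e ∈ atlas O2 M, ∀ x ∈ e.source, (val e x).IsHermitian
  compat : ∀ e ∈ atlas O2 M, ∀ e' ∈ atlas O2 M, ∀ x ∈ e.source ∩ e'.source, ∀ ξ : O2,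
    quadForm (val e' x) (fderiv ℝ (fun y => e' (e.symm y)) (e x) ξ) = quadForm (val e x) ξ

namespace HermSection

/-- The section is `C^∞`-smooth. -/
def Smooth (G : HermSection M) : Prop :=
  ∀ e ∈ atlas O2 M, ∀ i j a,
    ContDiffOn ℝ ∞ (fun y => (G.val e (e.symm y) i j).coord a) e.target

/-- The section is positive definite at each point. -/
def Positive (G : HermSection M) : Prop :=
  ∀ e ∈ atlas O2 M, ∀ x ∈ e.source, PosDef (G.val e x)

/-- The section is parallel for the flat connection, which is trivial in each chart of the
affine atlas. -/
def Parallel (G : HermSection M) : Prop :=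
  ∀ e ∈ atlas O2 M, ∀ y ∈ e.target, ∀ i j a,
    HasFDerivAt (fun z => (G.val e (e.symm z) i j).coord a) (0 : O2 →L[ℝ] ℝ) y

/-- Locally, the section is the octonionic Hessian of a `C^∞`-smooth function. -/
def HasLocalPotentials (G : HermSection M) : Prop :=
  ∀ p : M, ∃ U : Set M, IsOpen U ∧ p ∈ U ∧ ∃ u : M → ℝ,
    ContMDiffOn 𝓘(ℝ, O2) 𝓘(ℝ, ℝ) ∞ u U ∧
    ∀ e ∈ atlas O2 M, ∀ x ∈ e.source ∩ U, G.val e x = hessO (fun y => u (e.symm y)) (e x)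

end HermSection

/-- `det(G₀ + Hess_𝕆 φ) = e^f det G₀` on `M`. -/
def SolvesMA (G₀ : HermSection M) (f φ : M → ℝ) : Prop :=
  ∀ e ∈ atlas O2 M, ∀ x ∈ e.source,
    hdet (G₀.val e x + hessO (fun y => φ (e.symm y)) (e x)) = Real.exp (f x) * hdet (G₀.val e x)

/-- The value at `x` of `Δφ = tr(G₀₀⁻¹ Hess_𝕆 φ)`, computed in the chart `e`. -/
noncomputable def laplacian (G₀₀ : HermSection M) (φ : M → ℝ)
    (e : OpenPartialHomeomorph M O2) (x : M) : ℝ :=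
  reTr (hinv (G₀₀.val e x) * hessO (fun y => φ (e.symm y)) (e x))

/-- The `C^k` norm `∑_{m ≤ k} sup_M |D^m f|`, with `D` and `|·|` taken in the charts of the atlas. If
the transition maps are locally affine isometries, as for a `Spin(9)`-manifold, then
`|D^m f|` does not depend on the chart. -/
noncomputable def ckNorm (k : ℕ) (f : M → ℝ) : ℝ≥0∞ :=
  ∑ m ∈ Finset.range (k + 1), ⨆ e ∈ atlas O2 M, ⨆ x ∈ e.source,
    ‖iteratedFDeriv ℝ m (fun y => f (e.symm y)) (e x)‖ₑ

end OctMA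

open OctMA

/-!
The estimate is a maximum principle for the trace of `G = G₀ + Hess φ`, closed by a linear estimate
for the oscillation of `φ`.

In a chart `G` is the octonionic Hessian of a function `F` (a local potential of `G₀` plus `φ`), its
trace is the Euclidean Laplacian `lap F`, and the transition maps are local isometries, so
`T = tr G` is a function on `M` (`trM`). The form `hdet (a, b, q) = ab - |q|²` is Lorentzian, of
signature `(1, 9)`, with polarisation `polar`. Differentiating `hdet (hessO F) = exp ψ` twice in each
coordinate direction and using the reverse Cauchy–Schwarz inequality (`hdet_mul_hdet_le`) for the
quadratic terms gives `polar G (Hess T) ≥ exp ψ · Δψ` (`polar_hessO_lap_ge`). The operator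
`polar G ∘ Hess` is elliptic because `G` is positive (`polar_hessO_nonpos`); the multiplicativity of
the octonionic norm enters there. Since `Hess φ = G - G₀` and `polar G G₀` dominates a multiple of
`T`, the maximum principle for `T - s φ` gives `T(x₀) ≤ A + B / s` at its maximum point `x₀`
(`trM_le_of_isMax`), hence `T ≤ A + B / s + s · osc φ` on `M`, for every `s > 0`.

On the other hand `osc φ ≤ D · sup |Δφ|` with a constant that depends only on `M`: this follows from
a Harnack inequality for non-negative functions with bounded Laplacian (`harnack`), proved by
weighted mean values over balls and propagated over `M` by connectedness and compactness
(`exists_harnack`). As `|Δφ| ≤ sup T + const` (`T` is positive, `trM_pos`), the choice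
`s = 1 / (2D)` absorbs the oscillation and bounds `sup T`. So no separate `C⁰` estimate for the
nonlinear equation is needed. Finally `tr(G₀₀⁻¹ Hess φ) = polar G₀₀ (G - G₀) / hdet G₀₀`
(`reTr_hinv_mul`) is controlled by `T` and the eigenvalue bounds of `G₀₀` and `G₀`
(`exists_quadForm_bound`).
-/

namespace OctMA

/-! ### Octonions and the inner product -/

namespace Octonion

theorem coord_e (a b : Fin 8) : (e a).coord b = if b = a then 1 else 0 := by
  change (Pi.single a (1 : ℝ) : Fin 8 → ℝ) b = _
  simp [Pi.single_apply]

theorem coord_sum {ι : Type*} (s : Finset ι) (x : ι → Octonion) (c : Fin 8) :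
    (∑ i ∈ s, x i).coord c = ∑ i ∈ s, (x i).coord c :=
  map_sum (⟨⟨fun x : Octonion => x.coord c, rfl⟩, fun _ _ => rfl⟩ : Octonion →+ ℝ) x s

/-- The Euclidean inner product of the coordinate vectors. -/
def dot (x y : Octonion) : ℝ := ∑ c, x.coord c * y.coord c

theorem dot_self (x : Octonion) : dot x x = normSq x := by
  simp [dot, normSq, sq]

theorem normSq_nonneg (x : Octonion) : 0 ≤ normSq x :=
  Finset.sum_nonneg fun _ _ => sq_nonneg _

@[simp] theorem normSq_zero : normSq 0 = 0 := by simp [normSq]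

@[simp] theorem normSq_one : normSq 1 = 1 := by simp [normSq]

theorem normSq_mul (x y : Octonion) : normSq (x * y) = normSq x * normSq y := by
  simp only [normSq, Fin.sum_univ_eight, coord_mul, mulCoord]
  simp
  ring

theorem dot_mul_star (q x y : Octonion) : dot q (x * star y) = dot x (q * y) := by
  simp only [dot, Fin.sum_univ_eight, coord_mul, mulCoord, coord_star]
  simp
  ring

theorem dot_mul_mul (q x y : Octonion) : dot (q * x) (q * y) = normSq q * dot x y := by
  simp only [dot, normSq, Fin.sum_univ_eight, coord_mul, mulCoord]
  simp
  ring

theorem dot_sq_le (x y : Octonion) : dot x y ^ 2 ≤ normSq x * normSq y :=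
  Finset.sum_mul_sq_le_sq_mul_sq _ _ _

theorem star_mul_rev (x y : Octonion) : star (x * y) = star y * star x := by
  ext c
  fin_cases c <;> simp [mulCoord] <;> ring

theorem re_mul_star (x y : Octonion) : (x * star y).re = dot x y := by
  simp only [re, dot, Fin.sum_univ_eight, coord_mul, mulCoord, coord_star]
  simp

theorem re_star_mul (x y : Octonion) : (star x * y).re = dot x y := by
  simp only [re, dot, Fin.sum_univ_eight, coord_mul, mulCoord, coord_star]
  simp

theorem dot_comm (x y : Octonion) : dot x y = dot y x := by
  simp [dot, mul_comm]

theorem dot_star_mul (q x y : Octonion) : dot x (star q * y) = dot y (q * x) := by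
  simp only [dot, Fin.sum_univ_eight, coord_mul, mulCoord, coord_star]
  simp
  ring

theorem dot_e (a b : Fin 8) : dot (e a) (e b) = if a = b then 1 else 0 := by
  simp [dot, coord_e, eq_comm]

theorem dot_e_left (a : Fin 8) (x : Octonion) : dot (e a) x = x.coord a := by
  simp [dot, coord_e]

theorem normSq_add (x y : Octonion) : normSq (x + y) = normSq x + 2 * dot x y + normSq y := by
  simp only [normSq, dot, Finset.mul_sum, ← Finset.sum_add_distrib]
  exact Finset.sum_congr rfl fun c _ => by simp; ring

theorem normSq_smul (c : ℝ) (x : Octonion) : normSq (c • x) = c ^ 2 * normSq x := by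
  simp only [normSq, Finset.mul_sum]
  exact Finset.sum_congr rfl fun _ _ => by simp; ring

theorem dot_smul_right (c : ℝ) (x y : Octonion) : dot x (c • y) = c * dot x y := by
  simp only [dot, Finset.mul_sum]
  exact Finset.sum_congr rfl fun _ _ => by simp; ring

theorem dot_smul_smul (t s : ℝ) (x : Octonion) :
    dot (t • x) (s • x) = t * s * normSq x := by
  rw [dot_smul_right, dot_comm, dot_smul_right, dot_self]; ring

/-- The Lorentzian pairing of the vectors `(a, b, p)` and `(x, y, q)` of the closed future light cone
is non-negative, also after `q` is replaced by `-q`. -/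
theorem two_mul_abs_dot_le {p q : Octonion} {a b x y : ℝ} (ha : 0 ≤ a) (hb : 0 ≤ b)
    (hp : normSq p ≤ a * b) (hx : 0 ≤ x) (hy : 0 ≤ y) (hq : normSq q ≤ x * y) :
    |2 * dot p q| ≤ a * y + b * x := by
  have h0 := normSq_nonneg q
  have h1 : dot p q ^ 2 ≤ (a * y) * (b * x) := by
    calc dot p q ^ 2 ≤ normSq p * normSq q := dot_sq_le _ _
      _ ≤ (a * b) * (x * y) := by gcongr
      _ = _ := by ring
  have h2 : (2 * dot p q) ^ 2 ≤ (a * y + b * x) ^ 2 := by nlinarith [sq_nonneg (a * y - b * x)]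
  exact abs_le_of_sq_le_sq h2 (by positivity)

theorem mul_one_smul (q : Octonion) (s : ℝ) : q * (s • (1 : Octonion)) = s • q :=
  (smul_comm s q (1 : Octonion)).symm.trans (by rw [smul_eq_mul, mul_one])

end Octonion

/-! ### Hermitian matrices and their quadratic forms -/

open Octonion

theorem isHermitian_diag {A : Mat2} (hA : A.IsHermitian) (i : Fin 2) :
    A i i = (A i i).re • (1 : Octonion) := by
  have h : star (A i i) = A i i := hA.apply i i
  ext c
  by_cases hc : c = 0
  · subst hc; simp [re]
  · have := congrArg (fun x => x.coord c) h
    simp [hc] at this ⊢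
    linarith

theorem isHermitian_offDiag {A : Mat2} (hA : A.IsHermitian) : A 1 0 = star (A 0 1) :=
  (hA.apply 1 0).symm

theorem smul_one_mul (s : ℝ) (x : Octonion) : (s • (1 : Octonion)) * x = s • x := by
  ext c; fin_cases c <;> simp [mulCoord]

theorem quadForm_eq {A : Mat2} (hA : A.IsHermitian) (ξ : O2) :
    quadForm A ξ = (A 0 0).re * normSq (ξ.col 0) + (A 1 1).re * normSq (ξ.col 1)
      + 2 * dot (ξ.col 0) (A 0 1 * ξ.col 1) := by
  have radd : ∀ x y : Octonion, (x + y).re = x.re + y.re := fun _ _ => rfl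
  have dadd : ∀ x y z : Octonion, dot x (y + z) = dot x y + dot x z := fun x y z => by
    simp [dot, mul_add, Finset.sum_add_distrib]
  simp only [quadForm, dotProduct, Matrix.mulVec, Fin.sum_univ_two, radd, Pi.star_apply,
    re_star_mul]
  rw [isHermitian_offDiag hA, isHermitian_diag hA 0, isHermitian_diag hA 1]
  simp only [dadd, smul_one_mul, dot_smul_right, dot_self, dot_star_mul]
  have h1 : ∀ s : ℝ, (s • (1 : Octonion)).re = s := fun s => by simp [re]
  rw [h1, h1]; ring

theorem norm_sq_eq (ξ : O2) : ‖ξ‖ ^ 2 = normSq (ξ.col 0) + normSq (ξ.col 1) := by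
  rw [EuclideanSpace.norm_sq_eq, Fintype.sum_prod_type]
  simp [normSq, O2.col]

@[simp] theorem col_ofCol (q : Fin 2 → Octonion) : (O2.ofCol q).col = q := rfl

/-- If `A ≥ l` as quadratic forms, then `A - l` lies in the closed future light cone of the Lorentzian
form `hdet`. -/
theorem le_of_forall_quadForm_ge {A : Mat2} (hA : A.IsHermitian) {l : ℝ}
    (h : ∀ ξ, l * ‖ξ‖ ^ 2 ≤ quadForm A ξ) :
    l ≤ (A 0 0).re ∧ l ≤ (A 1 1).re ∧
      normSq (A 0 1) ≤ ((A 0 0).re - l) * ((A 1 1).re - l) := by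
  -- on the vectors `(t q, s)` the mixed term of the quadratic form is `2 t s |q|²`
  have key : ∀ s t : ℝ, 0 ≤ ((A 0 0).re - l) * t ^ 2 * normSq (A 0 1) + ((A 1 1).re - l) * s ^ 2
      + 2 * t * s * normSq (A 0 1) := by
    intro s t
    have := h (O2.ofCol ![t • A 0 1, s • 1])
    rw [quadForm_eq hA, norm_sq_eq, col_ofCol] at this
    simp only [Matrix.cons_val_zero, Matrix.cons_val_one, mul_one_smul, normSq_smul,
      dot_smul_smul, normSq_one] at this
    linarith
  have a0 : l ≤ (A 0 0).re := by
    have := h (O2.ofCol ![1, 0])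
    rw [quadForm_eq hA, norm_sq_eq, col_ofCol] at this
    simp [dot] at this
    linarith
  have b0 : l ≤ (A 1 1).re := by
    have := key 1 0
    linarith
  refine ⟨a0, b0, ?_⟩
  have hN := normSq_nonneg (A 0 1)
  set N := normSq (A 0 1)
  set a := (A 0 0).re - l
  set b := (A 1 1).re - l
  have ha : 0 ≤ a := sub_nonneg.2 a0
  have hb : 0 ≤ b := sub_nonneg.2 b0
  by_contra! hlt
  have hNpos : 0 < N := lt_of_le_of_lt (mul_nonneg ha hb) hlt
  rcases hb.eq_or_lt with hb0 | hb0
  · have := key (a + 1) (-1)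
    rw [← hb0] at this
    nlinarith
  · have := key (-N) b
    have h5 : 0 ≤ b * N * (a * b - N) := by nlinarith
    have : 0 ≤ a * b - N := nonneg_of_mul_nonneg_right h5 (mul_pos hb0 hNpos)
    linarith

theorem posDef_pos {A : Mat2} (hA : A.IsHermitian) (h : PosDef A) :
    0 < (A 0 0).re ∧ 0 < (A 1 1).re ∧ 0 < hdet A := by
  have ne : ∀ x y : Octonion, 0 < normSq x + normSq y → O2.ofCol ![x, y] ≠ 0 := by
    intro x y hxy h
    have := norm_sq_eq (O2.ofCol ![x, y])
    rw [col_ofCol, h] at this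
    simp at this
    linarith
  have a0 : 0 < (A 0 0).re := by
    have := h (O2.ofCol ![1, 0]) (ne _ _ (by simp))
    rw [quadForm_eq hA, col_ofCol] at this
    simpa [dot] using this
  have b0 : 0 < (A 1 1).re := by
    have := h (O2.ofCol ![0, 1]) (ne _ _ (by simp))
    rw [quadForm_eq hA, col_ofCol] at this
    simpa [dot] using this
  refine ⟨a0, b0, ?_⟩
  rcases (normSq_nonneg (A 0 1)).eq_or_lt with hN | hN
  · rw [hdet, ← hN]; simpa using mul_pos a0 b0
  · have := h (O2.ofCol ![(A 1 1).re • A 0 1, (-normSq (A 0 1)) • 1]) (ne _ _ (by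
      rw [normSq_smul, normSq_smul, normSq_one]; positivity))
    rw [quadForm_eq hA, col_ofCol] at this
    simp only [Matrix.cons_val_zero, Matrix.cons_val_one, mul_one_smul, normSq_smul,
      dot_smul_smul, normSq_one] at this
    have h5 : 0 < (A 1 1).re * normSq (A 0 1) * hdet A := by
      rw [hdet]; nlinarith
    exact pos_of_mul_pos_right h5 (by positivity)

/-- The converse of `le_of_forall_quadForm_ge`. -/
theorem quadForm_ge {A : Mat2} (hA : A.IsHermitian) {l : ℝ} (ha : l ≤ (A 0 0).re)
    (hb : l ≤ (A 1 1).re) (hq : normSq (A 0 1) ≤ ((A 0 0).re - l) * ((A 1 1).re - l)) (ξ : O2) :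
    l * ‖ξ‖ ^ 2 ≤ quadForm A ξ := by
  rw [quadForm_eq hA, norm_sq_eq]
  have hx := normSq_nonneg (ξ.col 0)
  have hy := normSq_nonneg (ξ.col 1)
  have hk : 2 * |dot (ξ.col 0) (A 0 1 * ξ.col 1)| ≤
      ((A 0 0).re - l) * normSq (ξ.col 0) + ((A 1 1).re - l) * normSq (ξ.col 1) := by
    have hd := dot_sq_le (ξ.col 0) (A 0 1 * ξ.col 1)
    rw [normSq_mul] at hd
    have ha0 := sub_nonneg.2 ha
    have hb0 := sub_nonneg.2 hb
    have h1 : dot (ξ.col 0) (A 0 1 * ξ.col 1) ^ 2 ≤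
        normSq (ξ.col 0) * ((((A 0 0).re - l) * ((A 1 1).re - l)) * normSq (ξ.col 1)) :=
      hd.trans (by gcongr)
    rw [← abs_two, ← abs_mul]
    refine abs_le_of_sq_le_sq ?_ (by positivity)
    nlinarith [sq_nonneg (((A 0 0).re - l) * normSq (ξ.col 0)
      - ((A 1 1).re - l) * normSq (ξ.col 1))]
  linarith [neg_abs_le (dot (ξ.col 0) (A 0 1 * ξ.col 1))]

theorem diag_le_of_forall_quadForm_le {A : Mat2} (hA : A.IsHermitian) {C : ℝ}
    (h : ∀ ξ, quadForm A ξ ≤ C * ‖ξ‖ ^ 2) : (A 0 0).re ≤ C ∧ (A 1 1).re ≤ C := by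
  have q0 := h (O2.ofCol ![1, 0])
  have q1 := h (O2.ofCol ![0, 1])
  rw [quadForm_eq hA, norm_sq_eq, col_ofCol] at q0 q1
  constructor
  · simpa [dot] using q0
  · simpa [dot] using q1

/-- For a positive definite matrix the smallest eigenvalue is at least `hdet A / (a + b)`. -/
theorem posDef_quadForm_ge {A : Mat2} (hA : A.IsHermitian) (h : PosDef A) (ξ : O2) :
    hdet A / ((A 0 0).re + (A 1 1).re) * ‖ξ‖ ^ 2 ≤ quadForm A ξ := by
  obtain ⟨ha, hb, hd⟩ := posDef_pos hA h
  have hN := normSq_nonneg (A 0 1)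
  have hdd : hdet A = (A 0 0).re * (A 1 1).re - normSq (A 0 1) := rfl
  set a := (A 0 0).re
  set b := (A 1 1).re
  have hab : 0 < a + b := by positivity
  refine quadForm_ge hA ?_ ?_ ?_ ξ
  · rw [div_le_iff₀ hab]; nlinarith
  · rw [div_le_iff₀ hab]; nlinarith
  · have : (a - hdet A / (a + b)) * (b - hdet A / (a + b))
        = normSq (A 0 1) + (hdet A / (a + b)) ^ 2 := by
      have : hdet A / (a + b) * (a + b) = hdet A := div_mul_cancel₀ _ hab.ne'
      set m := hdet A / (a + b)
      nlinarith
    rw [this]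
    linarith [sq_nonneg (hdet A / (a + b))]

/-! ### The Lorentzian form -/

/-- The polarisation `2B(A, X) = a x₁₁ + b x₀₀ - 2⟨q, x₀₁⟩` of the quadratic form `hdet`. -/
def polar (A X : Mat2) : ℝ :=
  (A 0 0).re * (X 1 1).re + (A 1 1).re * (X 0 0).re - 2 * dot (A 0 1) (X 0 1)

/-- The reverse Cauchy–Schwarz inequality for the form `hdet` of signature `(1, 9)`: it makes
`√hdet` concave on the cone of positive matrices. -/
theorem hdet_mul_hdet_le {A X : Mat2} (ha : 0 < (A 0 0).re) (hd : 0 < hdet A) :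
    4 * hdet A * hdet X ≤ polar A X ^ 2 := by
  -- the vector `X - t A` with `t = x₀₀ / a` has vanishing `(0, 0)` entry, so it is not timelike
  have h0 := normSq_nonneg (X 0 1 + (-((X 0 0).re / (A 0 0).re)) • A 0 1)
  rw [normSq_add, normSq_smul] at h0
  rw [dot_smul_right, Octonion.dot_comm (X 0 1)] at h0
  have hdd : hdet A = (A 0 0).re * (A 1 1).re - normSq (A 0 1) := rfl
  have hdX : hdet X = (X 0 0).re * (X 1 1).re - normSq (X 0 1) := rfl
  have hx : (X 0 0).re / (A 0 0).re * (A 0 0).re = (X 0 0).re := div_mul_cancel₀ _ ha.ne'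
  rw [polar, hdX]
  rw [hdd] at hd ⊢
  set t := (X 0 0).re / (A 0 0).re
  rw [← hx]
  set a := (A 0 0).re
  set b := (A 1 1).re
  set y := (X 1 1).re
  set k := dot (A 0 1) (X 0 1)
  set N := normSq (A 0 1)
  set Z := normSq (X 0 1)
  have h2 := mul_nonneg hd.le h0
  have h3 : (a * y + b * (t * a) - 2 * k) ^ 2 - 4 * (a * b - N) * (t * a * y - Z)
      = (a * (y - t * b) - 2 * (k - t * N)) ^ 2
        + 4 * ((a * b - N) * (Z + 2 * (-t * k) + (-t) ^ 2 * N)) := by ring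
  nlinarith [sq_nonneg (a * (y - t * b) - 2 * (k - t * N))]

/-- If `X - l` lies in the closed future light cone, then `polar A X` bounds the trace of a positive
matrix `A`. -/
theorem polar_ge {A X : Mat2} {l : ℝ} (ha : 0 < (A 0 0).re) (hd : 0 < hdet A)
    (hx : l ≤ (X 0 0).re) (hy : l ≤ (X 1 1).re)
    (hq : normSq (X 0 1) ≤ ((X 0 0).re - l) * ((X 1 1).re - l)) :
    l * ((A 0 0).re + (A 1 1).re) ≤ polar A X := by
  have hN := normSq_nonneg (A 0 1)
  have hdd : hdet A = (A 0 0).re * (A 1 1).re - normSq (A 0 1) := rfl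
  have hb : 0 < (A 1 1).re := by
    by_contra! hb
    nlinarith
  have h := (abs_le.1 (two_mul_abs_dot_le ha.le hb.le (by linarith) (sub_nonneg.2 hx)
    (sub_nonneg.2 hy) hq)).2
  rw [polar]
  linarith

/-! ### Directional derivatives -/

/-- The derivative of `F` in the direction `v`, as a function of the point. -/
noncomputable def dirD (v : O2) (F : O2 → ℝ) (y : O2) : ℝ := fderiv ℝ F y v

/-- The standard basis of `𝕆² = ℝ¹⁶`. -/
noncomputable def bas (P : Fin 2 × Fin 8) : O2 := EuclideanSpace.single P 1

/-- The Laplace operator of `ℝ¹⁶`. -/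
noncomputable def lap (F : O2 → ℝ) (y : O2) : ℝ := ∑ P, dirD (bas P) (dirD (bas P) F) y

section Derivatives

variable {Ω : Set O2} {F H : O2 → ℝ}

theorem contDiffOn_dirD {n m : WithTop ℕ∞} (hΩ : IsOpen Ω) (h : ContDiffOn ℝ n F Ω)
    (hmn : m + 1 ≤ n) (v : O2) : ContDiffOn ℝ m (dirD v F) Ω :=
  (h.fderiv_of_isOpen hΩ hmn).clm_apply contDiffOn_const

theorem dirD_congr (hΩ : IsOpen Ω) (h : Set.EqOn F H Ω) (v : O2) :
    Set.EqOn (dirD v F) (dirD v H) Ω := fun y hy => by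
  have : F =ᶠ[𝓝 y] H := h.eventuallyEq_of_mem (hΩ.mem_nhds hy)
  simp only [dirD, this.fderiv_eq]

theorem dirD_dirD_eq {y : O2} (h : ContDiffAt ℝ 2 F y) (v w : O2) :
    dirD v (dirD w F) y = fderiv ℝ (fderiv ℝ F) y v w := by
  have h1 : DifferentiableAt ℝ (fderiv ℝ F) y :=
    (h.fderiv_right (m := 1) (by norm_num)).differentiableAt (by norm_num)
  have : dirD w F = fun z => fderiv ℝ F z w := rfl
  rw [this, dirD, fderiv_clm_apply h1 (by fun_prop)]
  simp

theorem dirD_comm (hΩ : IsOpen Ω) (h : ContDiffOn ℝ 2 F Ω) (v w : O2) :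
    Set.EqOn (dirD v (dirD w F)) (dirD w (dirD v F)) Ω := fun y hy => by
  have h1 := h.contDiffAt (hΩ.mem_nhds hy)
  rw [dirD_dirD_eq h1, dirD_dirD_eq h1]
  exact (h1.isSymmSndFDerivAt (by simp)) v w

theorem hasDerivAt_line (hΩ : IsOpen Ω) (h : ContDiffOn ℝ 1 F Ω) (v : O2) {y : O2} (hy : y ∈ Ω) :
    HasDerivAt (fun t : ℝ => F (y + t • v)) (dirD v F y) 0 := by
  have h1 : HasFDerivAt F (fderiv ℝ F y) y :=
    ((h.contDiffAt (hΩ.mem_nhds hy)).differentiableAt (by norm_num)).hasFDerivAt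
  exact h1.hasLineDerivAt v

theorem dirD_eq_of_hasDerivAt (hΩ : IsOpen Ω) (h : ContDiffOn ℝ 1 F Ω) {v y : O2} (hy : y ∈ Ω)
    {d : ℝ} (hd : HasDerivAt (fun t : ℝ => F (y + t • v)) d 0) : dirD v F y = d :=
  (hasDerivAt_line hΩ h v hy).unique hd

/-! ### Components of the octonionic Hessian -/

theorem hessO_coord (F : O2 → ℝ) (y : O2) (i j : Fin 2) (c : Fin 8) :
    (hessO F y i j).coord c = ∑ a, ∑ b,
      dirD (bas (i, a)) (dirD (bas (j, b)) F) y * (e a * star (e b)).coord c := by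
  simp only [hessO, Matrix.of_apply, coord_sum]
  rfl

theorem contDiffOn_hessO {n m : WithTop ℕ∞} (hΩ : IsOpen Ω) (h : ContDiffOn ℝ n F Ω)
    (hmn : m + 1 + 1 ≤ n) (i j : Fin 2) (c : Fin 8) :
    ContDiffOn ℝ m (fun y => (hessO F y i j).coord c) Ω := by
  simp only [hessO_coord]
  refine ContDiffOn.sum fun a _ => ContDiffOn.sum fun b _ => ContDiffOn.mul ?_ contDiffOn_const
  exact contDiffOn_dirD hΩ (contDiffOn_dirD hΩ h hmn _) le_rfl _

theorem dirD_hessO (hΩ : IsOpen Ω) (h : ContDiffOn ℝ 3 F Ω) (v : O2) (i j : Fin 2) (c : Fin 8) :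
    Set.EqOn (dirD v fun y => (hessO F y i j).coord c)
      (fun y => (hessO (dirD v F) y i j).coord c) Ω := fun y hy => by
  have h3 : ∀ P, ContDiffOn ℝ 2 (dirD (bas P) F) Ω := fun P =>
    contDiffOn_dirD hΩ h (by norm_num) _
  refine dirD_eq_of_hasDerivAt hΩ (contDiffOn_hessO hΩ h (by norm_num) i j c) hy ?_
  simp only [hessO_coord]
  refine HasDerivAt.fun_sum fun a _ => HasDerivAt.fun_sum fun b _ => HasDerivAt.mul_const ?_ _
  have e1 : dirD (bas (i, a)) (dirD (bas (j, b)) (dirD v F)) y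
      = dirD v (dirD (bas (i, a)) (dirD (bas (j, b)) F)) y := by
    rw [dirD_congr hΩ (dirD_comm hΩ (h.of_le (by norm_num)) (bas (j, b)) v) _ hy,
      dirD_comm hΩ (h3 _) _ _ hy]
  rw [e1]
  exact hasDerivAt_line hΩ (contDiffOn_dirD hΩ (h3 _) (by norm_num) _) v hy

theorem dirD_dirD_sum {ι : Type*} (s : Finset ι) (f : ι → O2 → ℝ) {y : O2}
    (h : ∀ k ∈ s, ContDiffAt ℝ 2 (f k) y) (v w : O2) :
    dirD v (dirD w fun z => ∑ k ∈ s, f k z) y = ∑ k ∈ s, dirD v (dirD w (f k)) y := by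
  rw [dirD_dirD_eq (ContDiffAt.sum h)]
  have e1 : (fderiv ℝ fun z => ∑ k ∈ s, f k z) =ᶠ[𝓝 y] fun z => ∑ k ∈ s, fderiv ℝ (f k) z := by
    have : ∀ᶠ z in 𝓝 y, ∀ k ∈ s, DifferentiableAt ℝ (f k) z := by
      rw [Filter.eventually_all_finset]
      intro k hk
      filter_upwards [(h k hk).eventually (by simp)] with z hz
      exact hz.differentiableAt (by norm_num)
    filter_upwards [this] with z hz
    exact fderiv_fun_sum hz
  rw [e1.fderiv_eq, fderiv_fun_sum fun k hk =>
    ((h k hk).fderiv_right (m := 1) (by norm_num)).differentiableAt (by norm_num)]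
  simp only [sum_apply]
  exact Finset.sum_congr rfl fun k hk => (dirD_dirD_eq (h k hk) v w).symm

theorem dirD_dirD_const_mul {y : O2} (h : ContDiffAt ℝ 2 F y) (s : ℝ) (v w : O2) :
    dirD v (dirD w fun z => s * F z) y = s * dirD v (dirD w F) y := by
  have e1 : (dirD w fun z => s * F z) =ᶠ[𝓝 y] fun z => s * dirD w F z := by
    filter_upwards [h.eventually (by simp)] with z hz
    simp only [dirD]
    rw [fderiv_const_mul (hz.differentiableAt (by norm_num))]
    rfl
  have h0 : DifferentiableAt ℝ (fderiv ℝ F) y :=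
    (h.fderiv_right (m := 1) (by norm_num)).differentiableAt (by norm_num)
  have h1 : DifferentiableAt ℝ (dirD w F) y := h0.clm_apply (differentiableAt_const w)
  have : dirD v (dirD w fun z => s * F z) y = dirD v (fun z => s * dirD w F z) y := by
    simp only [dirD]
    exact congrArg (fun L : O2 →L[ℝ] ℝ => L v) e1.fderiv_eq
  rw [this]
  exact congrArg (fun L : O2 →L[ℝ] ℝ => L v) (fderiv_const_mul h1 s)

theorem dirD_dirD_add {y : O2} (hF : ContDiffAt ℝ 2 F y) (hH : ContDiffAt ℝ 2 H y) (v w : O2) :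
    dirD v (dirD w fun z => F z + H z) y = dirD v (dirD w F) y + dirD v (dirD w H) y := by
  have := dirD_dirD_sum Finset.univ ![F, H] (y := y)
    (by intro k _; fin_cases k <;> simpa) v w
  simpa using this

theorem hessO_sum {ι : Type*} (s : Finset ι) (f : ι → O2 → ℝ) {y : O2}
    (h : ∀ k ∈ s, ContDiffAt ℝ 2 (f k) y) :
    hessO (fun z => ∑ k ∈ s, f k z) y = ∑ k ∈ s, hessO (f k) y := by
  ext i j c
  rw [Matrix.sum_apply, coord_sum]
  simp only [hessO_coord, dirD_dirD_sum s f h, Finset.sum_mul]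
  symm
  rw [Finset.sum_comm]
  refine Finset.sum_congr rfl fun a _ => ?_
  rw [Finset.sum_comm]

theorem hessO_add {y : O2} (hF : ContDiffAt ℝ 2 F y) (hH : ContDiffAt ℝ 2 H y) :
    hessO (fun z => F z + H z) y = hessO F y + hessO H y := by
  ext i j c
  rw [Matrix.add_apply, coord_add]
  simp only [hessO_coord, dirD_dirD_add hF hH, add_mul, Finset.sum_add_distrib]

theorem hessO_const_mul {y : O2} (hF : ContDiffAt ℝ 2 F y) (s : ℝ) (i j : Fin 2) (c : Fin 8) :
    (hessO (fun z => s * F z) y i j).coord c = s * (hessO F y i j).coord c := by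
  simp only [hessO_coord, dirD_dirD_const_mul hF, Finset.mul_sum, mul_assoc]

theorem hessO_diag_re (F : O2 → ℝ) (y : O2) (i : Fin 2) :
    (hessO F y i i).re = ∑ a, dirD (bas (i, a)) (dirD (bas (i, a)) F) y := by
  have h : ∀ a b : Fin 8, (e a * star (e b)).coord 0 = if a = b then 1 else 0 := fun a b => by
    rw [← dot_e, ← re_mul_star]; rfl
  simp [re, hessO_coord, h]

theorem reTr_eq (A : Mat2) : reTr A = (A 0 0).re + (A 1 1).re := by
  simp [reTr, Matrix.trace, Fin.sum_univ_two, re]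

theorem reTr_hessO (F : O2 → ℝ) (y : O2) : reTr (hessO F y) = lap F y := by
  rw [reTr_eq, hessO_diag_re, hessO_diag_re, lap, Fintype.sum_prod_type, Fin.sum_univ_two]

theorem hessO_isHermitian {y : O2} (h : ContDiffAt ℝ 2 F y) : (hessO F y).IsHermitian := by
  refine Matrix.IsHermitian.ext fun i j => ?_
  have hsymm : ∀ v w, fderiv ℝ (fderiv ℝ F) y v w = fderiv ℝ (fderiv ℝ F) y w v :=
    h.isSymmSndFDerivAt (by simp)
  have hst : ∀ (x : Octonion) (c : Fin 8),
      (star x).coord c = (if c = 0 then 1 else -1) * x.coord c :=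
    fun x c => by by_cases hc : c = 0 <;> simp [hc]
  have hee : ∀ (a b c : Fin 8), (e a * star (e b)).coord c
      = (if c = 0 then 1 else -1) * (e b * star (e a)).coord c := fun a b c => by
    rw [← hst, star_mul_rev]
    congr 2
    ext d; by_cases hd : d = 0 <;> simp [hd]
  ext c
  rw [hst, hessO_coord, hessO_coord, Finset.mul_sum, Finset.sum_comm]
  refine Finset.sum_congr rfl fun a _ => ?_
  rw [Finset.mul_sum]
  refine Finset.sum_congr rfl fun b _ => ?_
  rw [hee b a c, dirD_dirD_eq h, dirD_dirD_eq h, hsymm (bas (j, a))]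
  ring

/-! ### Ellipticity and the maximum principle -/

/-- Second directional derivatives are non-positive at a local maximum. -/
theorem dirD_dirD_nonpos {y : O2} (h : ContDiffAt ℝ 2 F y) (hmax : IsLocalMax F y) (v : O2) :
    dirD v (dirD v F) y ≤ 0 := by
  obtain ⟨Ω, hΩ, hyΩ, hF⟩ : ∃ Ω, IsOpen Ω ∧ y ∈ Ω ∧ ContDiffOn ℝ 2 F Ω := by
    obtain ⟨u, hu, hF⟩ := h.contDiffOn (m := 2) le_rfl (by simp)
    obtain ⟨w, hw, hwo, hyw⟩ := mem_nhds_iff.1 hu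
    exact ⟨w, hwo, hyw, hF.mono hw⟩
  -- a positive second derivative makes the point a strict minimum on the line, so that `F` is
  -- constant there
  by_contra! hpos
  have hline : Continuous fun t : ℝ => y + t • v := by fun_prop
  have hev : ∀ᶠ t : ℝ in 𝓝 0, y + t • v ∈ Ω := by
    refine hline.continuousAt.eventually_mem (hΩ.mem_nhds ?_)
    simpa
  have hd : ∀ᶠ t : ℝ in 𝓝 0,
      HasDerivAt (fun t : ℝ => F (y + t • v)) (dirD v F (y + t • v)) t := by
    filter_upwards [hev] with t ht
    have h1 := hasDerivAt_line hΩ (hF.of_le (by norm_num)) v ht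
    have h2 := HasDerivAt.comp_sub_const (f := fun s : ℝ => F (y + t • v + s • v)) t t
      (by simpa using h1)
    refine h2.congr_of_eventuallyEq (Filter.Eventually.of_forall fun s => ?_)
    simp only [add_assoc, ← add_smul]
    congr 3; ring
  have hdd : HasDerivAt (fun t : ℝ => dirD v F (y + t • v)) (dirD v (dirD v F) y) 0 :=
    hasDerivAt_line hΩ (contDiffOn_dirD hΩ hF (by norm_num) v) v hyΩ
  have hloc : IsLocalMax (fun t : ℝ => F (y + t • v)) 0 := by
    refine IsLocalMax.comp_continuous (f := F) (g := fun t : ℝ => y + t • v) (b := 0) ?_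
      hline.continuousAt
    simpa using hmax
  have hderiv : deriv (fun t : ℝ => F (y + t • v)) =ᶠ[𝓝 0] fun t => dirD v F (y + t • v) := by
    filter_upwards [hd] with t ht using ht.deriv
  have hmin : IsLocalMin (fun t : ℝ => F (y + t • v)) 0 := by
    refine isLocalMin_of_deriv_deriv_pos ?_ hloc.deriv_eq_zero
      hd.self_of_nhds.continuousAt
    rw [hderiv.deriv_eq, hdd.deriv]
    exact hpos
  have hconst : (fun t : ℝ => F (y + t • v)) =ᶠ[𝓝 0] fun _ => F (y + (0 : ℝ) • v) := by
    filter_upwards [hmin, hloc] with t h1 h2 using le_antisymm h2 h1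
  have h0 : deriv (deriv fun t : ℝ => F (y + t • v)) 0 = 0 := by
    rw [hconst.deriv.deriv_eq]; simp
  rw [hderiv.deriv_eq, hdd.deriv] at h0
  exact hpos.ne' h0

/-- The vector of `𝕆²` with octonionic coordinates `(s e_a, -q̄ e_a)`. For `q` and `s` the entries
`A 0 1` and `A 1 1` of a matrix `A`, the second derivatives along these vectors add up to a multiple
of the operator `polar A ∘ hessO`, up to a multiple of the Laplacian in the second variable. -/
noncomputable def twist (q : Octonion) (s : ℝ) (a : Fin 8) : O2 :=
  s • bas (0, a) - ∑ b, (q * e b).coord a • bas (1, b)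

/-- The sum over `a` of `B` at the vectors `twist q s a`. The last term is diagonal because right
multiplication by the unit vectors `e b` is orthogonal: `⟨q e_b, q e_b'⟩ = |q|² ⟨e_b, e_b'⟩`. -/
theorem sum_twist (q : Octonion) (s : ℝ) (B : O2 →L[ℝ] O2 →L[ℝ] ℝ) (hB : ∀ v w, B v w = B w v) :
    ∑ a, B (twist q s a) (twist q s a) = s ^ 2 * ∑ a, B (bas (0, a)) (bas (0, a))
      - 2 * s * ∑ a, ∑ b, B (bas (0, a)) (bas (1, b)) * (q * e b).coord a
      + normSq q * ∑ b, B (bas (1, b)) (bas (1, b)) := by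
  have e1 : ∀ a, B (twist q s a) (twist q s a) = s ^ 2 * B (bas (0, a)) (bas (0, a))
      - 2 * s * ∑ b, B (bas (0, a)) (bas (1, b)) * (q * e b).coord a
      + ∑ b, ∑ b', (q * e b).coord a * (q * e b').coord a * B (bas (1, b)) (bas (1, b')) := by
    intro a
    set u := s • bas (0, a) with hu
    set w := ∑ b, (q * e b).coord a • bas (1, b) with hw
    have h1 : B (u - w) (u - w) = B u u - 2 * B u w + B w w := by
      simp only [map_sub, sub_apply]
      rw [hB w u]; ring
    have h2 : B u u = s ^ 2 * B (bas (0, a)) (bas (0, a)) := by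
      simp only [hu, map_smul, smul_apply, smul_eq_mul]; ring
    have h3 : B u w = s * ∑ b, B (bas (0, a)) (bas (1, b)) * (q * e b).coord a := by
      simp only [hu, hw, map_smul, map_sum, smul_apply, smul_eq_mul, Finset.mul_sum]
      exact Finset.sum_congr rfl fun b _ => by ring
    have h4 : B w w = ∑ b, ∑ b', (q * e b).coord a * (q * e b').coord a *
        B (bas (1, b)) (bas (1, b')) := by
      simp only [hw, map_sum, sum_apply, map_smul, smul_apply, smul_eq_mul]
      rw [Finset.sum_comm]
      refine Finset.sum_congr rfl fun b _ => ?_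
      rw [Finset.mul_sum]
      exact Finset.sum_congr rfl fun b' _ => by ring
    rw [twist, h1, h2, h3, h4]; ring
  simp only [e1, Finset.sum_add_distrib, Finset.sum_sub_distrib, Finset.mul_sum]
  congr 1
  rw [Finset.sum_comm]
  refine Finset.sum_congr rfl fun b _ => ?_
  rw [Finset.sum_comm]
  have h4 : ∀ b', ∑ a, (q * e b).coord a * (q * e b').coord a * B (bas (1, b)) (bas (1, b'))
      = normSq q * (if b = b' then 1 else 0) * B (bas (1, b)) (bas (1, b')) := fun b' => by
    rw [← dot_e, ← dot_mul_mul, dot, Finset.sum_mul]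
  rw [Finset.sum_congr rfl fun b' _ => h4 b']
  simp

theorem dot_hessO (F : O2 → ℝ) (y : O2) (q : Octonion) : dot q (hessO F y 0 1)
    = ∑ a, ∑ b, dirD (bas (0, a)) (dirD (bas (1, b)) F) y * (q * e b).coord a := by
  have h : ∀ a b : Fin 8, (q * e b).coord a = ∑ c, q.coord c * (e a * star (e b)).coord c :=
    fun a b => by rw [← dot_e_left, ← dot_mul_star]; rfl
  simp only [dot, hessO_coord, h, Finset.mul_sum]
  rw [Finset.sum_comm]
  refine Finset.sum_congr rfl fun a _ => ?_
  rw [Finset.sum_comm]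
  refine Finset.sum_congr rfl fun b _ => Finset.sum_congr rfl fun c _ => by ring

/-- The operator `F ↦ polar A (hessO F)` is elliptic for positive `A`: it is non-positive at a
local maximum. -/
theorem polar_hessO_nonpos {A : Mat2} (ha : 0 < (A 0 0).re) (hd : 0 < hdet A) {y : O2}
    (h : ContDiffAt ℝ 2 F y) (hmax : IsLocalMax F y) : polar A (hessO F y) ≤ 0 := by
  have hN := normSq_nonneg (A 0 1)
  have hdd : hdet A = (A 0 0).re * (A 1 1).re - normSq (A 0 1) := rfl
  have hb : 0 < (A 1 1).re := by
    by_contra! hb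
    nlinarith
  have h1 := sum_twist (A 0 1) (A 1 1).re (fderiv ℝ (fderiv ℝ F) y)
    (h.isSymmSndFDerivAt (by simp))
  have h2 : ∑ a, fderiv ℝ (fderiv ℝ F) y (twist (A 0 1) (A 1 1).re a)
      (twist (A 0 1) (A 1 1).re a) ≤ 0 := Finset.sum_nonpos fun a _ => by
    rw [← dirD_dirD_eq h]
    exact dirD_dirD_nonpos h hmax _
  have h3 : (hessO F y 1 1).re ≤ 0 := by
    rw [hessO_diag_re]
    exact Finset.sum_nonpos fun a _ => dirD_dirD_nonpos h hmax _
  simp only [← dirD_dirD_eq h] at h1 h2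
  rw [← hessO_diag_re, ← hessO_diag_re, ← dot_hessO] at h1
  rw [h1] at h2
  rw [polar]
  set a := (A 0 0).re
  set b := (A 1 1).re
  have h4 : b * (a * (hessO F y 1 1).re + b * (hessO F y 0 0).re
      - 2 * dot (A 0 1) (hessO F y 0 1)) ≤ 0 := by nlinarith
  exact nonpos_of_mul_nonpos_right h4 hb

/-! ### Differentiating the equation twice -/

theorem hdet_eq_polar (A : Mat2) : hdet A = polar A A / 2 := by
  rw [polar, dot_self, hdet]; ring

theorem hasDerivAt_polar {X Y : ℝ → Mat2} {X' Y' : Mat2} {t : ℝ}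
    (hX : ∀ i j c, HasDerivAt (fun s => (X s i j).coord c) ((X' i j).coord c) t)
    (hY : ∀ i j c, HasDerivAt (fun s => (Y s i j).coord c) ((Y' i j).coord c) t) :
    HasDerivAt (fun s => polar (X s) (Y s)) (polar X' (Y t) + polar (X t) Y') t := by
  have : HasDerivAt (fun s => polar (X s) (Y s)) _ t :=
    (((hX 0 0 0).mul (hY 1 1 0)).add ((hX 1 1 0).mul (hY 0 0 0))).sub
    ((HasDerivAt.fun_sum (u := Finset.univ) fun c _ => (hX 0 1 c).mul (hY 0 1 c)).const_mul 2)
  refine this.congr_deriv ?_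
  simp only [polar, re, dot, Finset.sum_add_distrib]
  ring

theorem polar_comm (A X : Mat2) : polar A X = polar X A := by
  rw [polar, polar, Octonion.dot_comm]; ring

theorem polar_sum {ι : Type*} (s : Finset ι) (A : Mat2) (X : ι → Mat2) :
    polar A (∑ k ∈ s, X k) = ∑ k ∈ s, polar A (X k) := by
  simp only [polar, re, dot, Matrix.sum_apply, coord_sum, Finset.mul_sum, Finset.sum_add_distrib,
    Finset.sum_sub_distrib]
  congr 1
  exact Finset.sum_comm

variable {ψ : O2 → ℝ}

/-- Differentiating `hdet (hessO F) = exp ψ` twice along `v` yields the term `2 hdet (hessO (∂ᵥF))`,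
which the reverse Cauchy–Schwarz inequality and the first derivative of the equation bound by
`exp ψ (∂ᵥψ)² / 2`. -/
theorem polar_hessO_dirD_dirD_ge (hΩ : IsOpen Ω) (hF : ContDiffOn ℝ 4 F Ω)
    (hψ : ContDiffOn ℝ 2 ψ Ω) (heq : ∀ z ∈ Ω, hdet (hessO F z) = Real.exp (ψ z)) {y : O2}
    (hy : y ∈ Ω) (ha : 0 < (hessO F y 0 0).re) (v : O2) :
    Real.exp (ψ y) * dirD v (dirD v ψ) y ≤ polar (hessO F y) (hessO (dirD v (dirD v F)) y) := by
  have hF' : ContDiffOn ℝ 3 (dirD v F) Ω := contDiffOn_dirD hΩ hF (by norm_num) v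
  have hψ' : ContDiffOn ℝ 1 (dirD v ψ) Ω := contDiffOn_dirD hΩ hψ (by norm_num) v
  have hcomp : ∀ {H : O2 → ℝ}, ContDiffOn ℝ 3 H Ω → ∀ z ∈ Ω, ∀ i j c,
      HasDerivAt (fun t : ℝ => (hessO H (z + t • v) i j).coord c)
        ((hessO (dirD v H) z i j).coord c) 0 := by
    intro H hH z hz i j c
    exact (hasDerivAt_line hΩ (contDiffOn_hessO hΩ hH (by norm_num) i j c) v hz).congr_deriv
      (dirD_hessO hΩ hH v i j c hz)
  have hnear : ∀ z ∈ Ω, ∀ᶠ t : ℝ in 𝓝 0, z + t • v ∈ Ω := fun z hz => by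
    have hline : Continuous fun t : ℝ => z + t • v := by fun_prop
    refine hline.continuousAt.eventually_mem (hΩ.mem_nhds ?_)
    simpa
  have first : ∀ z ∈ Ω, polar (hessO F z) (hessO (dirD v F) z)
      = Real.exp (ψ z) * dirD v ψ z := by
    intro z hz
    have h1 := (hasDerivAt_polar (hcomp (hF.of_le (by norm_num)) z hz)
      (hcomp (hF.of_le (by norm_num)) z hz)).div_const 2
    have h2 := (hasDerivAt_line hΩ (hψ.of_le (by norm_num)) v hz).exp
    have h3 : (fun t : ℝ => polar (hessO F (z + t • v)) (hessO F (z + t • v)) / 2)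
        =ᶠ[𝓝 0] fun t => Real.exp (ψ (z + t • v)) := by
      filter_upwards [hnear z hz] with t ht
      rw [← hdet_eq_polar, heq _ ht]
    have h4 := h1.unique (h2.congr_of_eventuallyEq h3)
    rw [polar_comm (hessO (dirD v F) z)] at h4
    simp only [zero_smul, add_zero] at h4
    linarith
  have h1 := hasDerivAt_polar (hcomp (hF.of_le (by norm_num)) y hy) (hcomp hF' y hy)
  have h2 := ((hasDerivAt_line hΩ (hψ.of_le (by norm_num)) v hy).exp).mul
    (hasDerivAt_line hΩ hψ' v hy)
  have h3 : (fun t : ℝ => polar (hessO F (y + t • v)) (hessO (dirD v F) (y + t • v)))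
      =ᶠ[𝓝 0] fun t => Real.exp (ψ (y + t • v)) * dirD v ψ (y + t • v) := by
    filter_upwards [hnear y hy] with t ht using first _ ht
  have h4 := h1.unique (h2.congr_of_eventuallyEq h3)
  simp only [zero_smul, add_zero] at h4
  have h5 : polar (hessO (dirD v F) y) (hessO (dirD v F) y) = 2 * hdet (hessO (dirD v F) y) := by
    rw [hdet_eq_polar]; ring
  have h6 := hdet_mul_hdet_le (X := hessO (dirD v F) y) ha
    (by rw [heq y hy]; exact Real.exp_pos _)
  rw [first y hy, heq y hy] at h6
  rw [h5] at h4
  have hpos := Real.exp_pos (ψ y)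
  set E := Real.exp (ψ y)
  set D := hdet (hessO (dirD v F) y)
  set p := dirD v ψ y
  have h7 : 4 * D ≤ E * p ^ 2 := by
    refine le_of_mul_le_mul_left ?_ hpos
    linarith
  have : 0 ≤ E * p ^ 2 := by positivity
  nlinarith

/-- The second order differential inequality for the Laplacian of a solution of
`hdet (hessO F) = exp ψ`. -/
theorem polar_hessO_lap_ge (hΩ : IsOpen Ω) (hF : ContDiffOn ℝ 4 F Ω)
    (hψ : ContDiffOn ℝ 2 ψ Ω) (heq : ∀ z ∈ Ω, hdet (hessO F z) = Real.exp (ψ z)) {y : O2}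
    (hy : y ∈ Ω) (ha : 0 < (hessO F y 0 0).re) :
    Real.exp (ψ y) * lap ψ y ≤ polar (hessO F y) (hessO (lap F) y) := by
  have e1 : lap F = fun z => ∑ P, dirD (bas P) (dirD (bas P) F) z := rfl
  rw [e1, hessO_sum, polar_sum, lap, Finset.mul_sum]
  · exact Finset.sum_le_sum fun P _ => polar_hessO_dirD_dirD_ge hΩ hF hψ heq hy ha _
  · intro P _
    exact (contDiffOn_dirD hΩ (contDiffOn_dirD hΩ hF (m := 3) (by norm_num) _)
      (by norm_num) _).contDiffAt (hΩ.mem_nhds hy)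

theorem contDiffOn_lap (hΩ : IsOpen Ω) (hF : ContDiffOn ℝ 4 F Ω) : ContDiffOn ℝ 2 (lap F) Ω :=
  ContDiffOn.sum fun _ _ => contDiffOn_dirD hΩ (contDiffOn_dirD hΩ hF (m := 3) (by norm_num) _)
      (by norm_num) _

end Derivatives

open MeasureTheory

/-! ### Weighted mean values and a Harnack inequality -/

/-- The truncated powers `(1 - ‖z‖²)₊ⁿ`: for `n = 2` the weight of the mean values, for `n = 3` its
primitive, since `∇(1 - ‖z‖²)₊³ = -6 (1 - ‖z‖²)₊² z`. -/
noncomputable def truncPow (n : ℕ) (z : O2) : ℝ := max 0 (1 - ‖z‖ ^ 2) ^ n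

theorem truncPow_nonneg (n : ℕ) (z : O2) : 0 ≤ truncPow n z := pow_nonneg (le_max_left _ _) _

theorem truncPow_eq_zero {n : ℕ} (hn : n ≠ 0) {z : O2} (hz : 1 ≤ ‖z‖) : truncPow n z = 0 := by
  have : 1 - ‖z‖ ^ 2 ≤ 0 := by nlinarith
  rw [truncPow, max_eq_left this, zero_pow hn]

theorem truncPow_base_le (z : O2) : max 0 (1 - ‖z‖ ^ 2) ≤ 1 :=
  max_le zero_le_one (by nlinarith [sq_nonneg ‖z‖])

theorem truncPow_three_le (z : O2) : truncPow 3 z ≤ truncPow 2 z :=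
  pow_le_pow_of_le_one (le_max_left _ _) (truncPow_base_le z) (by norm_num)

theorem continuous_truncPow (n : ℕ) : Continuous (truncPow n) := by
  unfold truncPow; fun_prop

theorem hasCompactSupport_truncPow {n : ℕ} (hn : n ≠ 0) : HasCompactSupport (truncPow n) := by
  refine HasCompactSupport.intro (isCompact_closedBall (0 : O2) 1) fun z hz => ?_
  refine truncPow_eq_zero hn ?_
  simp only [Metric.mem_closedBall, dist_zero_right, not_le] at hz
  exact hz.le

theorem hasDerivAt_max_pow_three (s : ℝ) :
    HasDerivAt (fun s : ℝ => max 0 s ^ 3) (3 * max 0 s ^ 2) s := by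
  rcases lt_trichotomy s 0 with h | h | h
  · rw [max_eq_left h.le]
    refine HasDerivAt.congr_of_eventuallyEq (f := fun _ => (0 : ℝ)) ?_ ?_
    · simpa using hasDerivAt_const s (0 : ℝ)
    · filter_upwards [gt_mem_nhds h] with t ht
      simp [max_eq_left ht.le]
  · subst h
    have : (fun s : ℝ => max 0 s ^ 3) =O[𝓝 0] fun s => ‖s - 0‖ ^ 3 := by
      refine Asymptotics.IsBigO.of_bound 1 (Filter.Eventually.of_forall fun t => ?_)
      simp only [sub_zero, norm_pow, norm_norm, one_mul]
      gcongr
      rw [Real.norm_eq_abs, Real.norm_eq_abs, abs_of_nonneg (le_max_left _ _)]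
      exact max_le (abs_nonneg _) (le_abs_self _)
    have h := (this.hasFDerivAt (by norm_num)).hasDerivAt
    simpa using h
  · rw [max_eq_right h.le]
    refine HasDerivAt.congr_of_eventuallyEq (f := fun t : ℝ => t ^ 3) ?_ ?_
    · simpa using hasDerivAt_pow 3 s
    · filter_upwards [lt_mem_nhds h] with t ht
      simp [max_eq_right ht.le]

theorem hasFDerivAt_truncPow_three (z : O2) :
    HasFDerivAt (truncPow 3) ((-6 * truncPow 2 z) • innerSL ℝ z) z := by
  have h1 : HasFDerivAt (fun z : O2 => 1 - ‖z‖ ^ 2) (-(2 • innerSL ℝ z)) z :=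
    (hasStrictFDerivAt_norm_sq z).hasFDerivAt.const_sub 1
  have h2 := (hasDerivAt_max_pow_three (1 - ‖z‖ ^ 2)).comp_hasFDerivAt z h1
  refine h2.congr_fderiv ?_
  ext v
  simp [truncPow]
  ring

theorem inner_bas (z : O2) (P : Fin 2 × Fin 8) : inner ℝ z (bas P) = z P := by
  simp [bas, EuclideanSpace.inner_single_right]

theorem sum_smul_bas (z : O2) : ∑ P, z P • bas P = z := by
  ext Q
  simp [bas, Pi.single_apply]

/-- The weighted mean value (up to normalisation) of `F` over the ball of radius `t` about `x`. -/
noncomputable def wmean (F : O2 → ℝ) (x : O2) (t : ℝ) : ℝ := ∫ z, truncPow 2 z * F (x + t • z)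

section MeanValue

variable {F : O2 → ℝ}

theorem integrable_truncPow_mul {n : ℕ} (hn : n ≠ 0) {g : O2 → ℝ} (hg : Continuous g) :
    Integrable fun z => truncPow n z * g z :=
  ((continuous_truncPow n).mul hg).integrable_of_hasCompactSupport
    (hasCompactSupport_truncPow hn).mul_right

theorem continuous_lap (hF : ContDiff ℝ 2 F) : Continuous (lap F) :=
  continuous_finsetSum _ fun P _ => by
    have h1 : ContDiffOn ℝ 0 (dirD (bas P) (dirD (bas P) F)) Set.univ :=
      contDiffOn_dirD isOpen_univ (contDiffOn_dirD (m := 1) isOpen_univ hF.contDiffOn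
        (by norm_num) _) (by norm_num) _
    exact continuousOn_univ.1 h1.continuousOn

/-- Integration by parts against the weight. -/
theorem integral_truncPow_mul_fderiv (hF : ContDiff ℝ 2 F) (x : O2) (t : ℝ) :
    ∫ z, truncPow 2 z * fderiv ℝ F (x + t • z) z
      = t / 6 * ∫ z, truncPow 3 z * lap F (x + t • z) := by
  have hline : Continuous fun z : O2 => x + t • z := by fun_prop
  have hg1 : ∀ P, ContDiff ℝ 1 (dirD (bas P) F) := fun P =>
    contDiffOn_univ.1 (contDiffOn_dirD isOpen_univ hF.contDiffOn (by norm_num) _)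
  have hg2 : ∀ P, Continuous (dirD (bas P) (dirD (bas P) F)) := fun P =>
    ((hg1 P).continuous_fderiv (by norm_num)).clm_apply continuous_const
  have hd : ∀ P z, HasFDerivAt (fun z => dirD (bas P) F (x + t • z))
      ((fderiv ℝ (dirD (bas P) F) (x + t • z)).comp (t • ContinuousLinearMap.id ℝ O2)) z := by
    intro P z
    exact (((hg1 P).differentiable (by norm_num)) (x + t • z)).hasFDerivAt.comp z
      (((hasFDerivAt_id z).const_smul t).const_add x)
  have ibp : ∀ P, ∫ z, truncPow 2 z * (z P * dirD (bas P) F (x + t • z))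
      = t / 6 * ∫ z, truncPow 3 z * dirD (bas P) (dirD (bas P) F) (x + t • z) := by
    intro P
    have e1 : ∀ z, fderiv ℝ (fun z => dirD (bas P) F (x + t • z)) z (bas P)
        = t * dirD (bas P) (dirD (bas P) F) (x + t • z) := fun z => by
      rw [(hd P z).fderiv]
      simp [dirD]
    have e2 : ∀ z, fderiv ℝ (truncPow 3) z (bas P) = -6 * (truncPow 2 z * z P) := fun z => by
      rw [(hasFDerivAt_truncPow_three z).fderiv]
      simp [inner_bas]
      ring
    have hP : Continuous fun z : O2 => z P := by fun_prop
    have hc : Continuous fun z => dirD (bas P) F (x + t • z) := (hg1 P).continuous.comp hline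
    have := integral_mul_fderiv_eq_neg_fderiv_mul_of_integrable (μ := (volume : Measure O2))
      (f := truncPow 3) (g := fun z => dirD (bas P) F (x + t • z)) (v := bas P) ?_ ?_ ?_
      (fun z _ => (hasFDerivAt_truncPow_three z).differentiableAt)
      (fun z _ => (hd P z).differentiableAt)
    · simp only [e1, e2] at this
      have l1 : ∀ z : O2, -6 * (truncPow 2 z * z P) * dirD (bas P) F (x + t • z)
          = -6 * (truncPow 2 z * (z P * dirD (bas P) F (x + t • z))) := fun z => by ring
      have l2 : ∀ z : O2, truncPow 3 z * (t * dirD (bas P) (dirD (bas P) F) (x + t • z))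
          = t * (truncPow 3 z * dirD (bas P) (dirD (bas P) F) (x + t • z)) := fun z => by ring
      simp only [l1, l2, integral_const_mul] at this
      linarith
    · simp only [e2]
      have := (integrable_truncPow_mul (n := 2) (by norm_num) (hP.mul hc)).const_mul (-6)
      refine this.congr (Filter.Eventually.of_forall fun z => ?_)
      simp only [Pi.mul_apply]; ring
    · simp only [e1]
      exact integrable_truncPow_mul (by norm_num) (continuous_const.mul ((hg2 P).comp hline))
    · exact integrable_truncPow_mul (by norm_num) hc
  have e3 : ∀ z, truncPow 2 z * fderiv ℝ F (x + t • z) z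
      = ∑ P, truncPow 2 z * (z P * dirD (bas P) F (x + t • z)) := fun z => by
    rw [← Finset.mul_sum]
    congr 1
    conv_lhs => rw [← sum_smul_bas z, map_sum]
    rw [sum_smul_bas]
    simp only [map_smul, smul_eq_mul, dirD]
  simp only [e3]
  rw [integral_finsetSum]
  · simp only [ibp, lap, Finset.mul_sum]
    rw [integral_finsetSum, Finset.mul_sum]
    intro P _
    exact integrable_truncPow_mul (by norm_num) ((hg2 P).comp hline)
  · intro P _
    have hP : Continuous fun z : O2 => z P := by fun_prop
    exact integrable_truncPow_mul (by norm_num) (hP.mul ((hg1 P).continuous.comp hline))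

theorem hasDerivAt_wmean (hF : ContDiff ℝ 2 F) (hFc : HasCompactSupport F) (x : O2) (t : ℝ) :
    HasDerivAt (wmean F x) (t / 6 * ∫ z, truncPow 3 z * lap F (x + t • z)) t := by
  rw [← integral_truncPow_mul_fderiv hF]
  have hdF : Continuous (fderiv ℝ F) := hF.continuous_fderiv (by norm_num)
  obtain ⟨C, hC⟩ := hdF.bounded_above_of_compact_support (hFc.fderiv ℝ)
  have hcont : ∀ t : ℝ, Continuous fun z : O2 => x + t • z := fun t => by fun_prop
  refine (hasDerivAt_integral_of_dominated_loc_of_deriv_le (μ := (volume : Measure O2))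
    (F := fun t z => truncPow 2 z * F (x + t • z))
    (F' := fun t z => truncPow 2 z * fderiv ℝ F (x + t • z) z)
    (bound := fun z => truncPow 2 z * (C * ‖z‖)) Filter.univ_mem ?_ ?_ ?_ ?_ ?_ ?_).2
  · exact Filter.Eventually.of_forall fun s =>
      (integrable_truncPow_mul (by norm_num) (hF.continuous.comp (hcont s))).aestronglyMeasurable
  · exact integrable_truncPow_mul (by norm_num) (hF.continuous.comp (hcont t))
  · exact (integrable_truncPow_mul (by norm_num)
      ((hdF.comp (hcont t)).clm_apply continuous_id)).aestronglyMeasurable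
  · refine Filter.Eventually.of_forall fun z s _ => ?_
    rw [norm_mul, Real.norm_of_nonneg (truncPow_nonneg _ _)]
    gcongr
    · exact truncPow_nonneg _ _
    · exact (ContinuousLinearMap.le_opNorm _ _).trans (by gcongr; exact hC _)
  · exact integrable_truncPow_mul (by norm_num) (by fun_prop)
  · refine Filter.Eventually.of_forall fun z s _ => ?_
    refine HasDerivAt.const_mul _ ?_
    have h1 : HasDerivAt (fun s : ℝ => x + s • z) z s := by
      simpa using ((hasDerivAt_id s).smul_const z).const_add x
    exact ((hF.differentiable (by norm_num)) _).hasFDerivAt.comp_hasDerivAt s h1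

/-- The total mass of the weight. -/
noncomputable def wmass : ℝ := ∫ z, truncPow 2 z

theorem integrable_truncPow {n : ℕ} (hn : n ≠ 0) : Integrable (truncPow n) :=
  (continuous_truncPow n).integrable_of_hasCompactSupport (hasCompactSupport_truncPow hn)

theorem wmass_pos : 0 < wmass := by
  refine (continuous_truncPow 2).integral_pos_of_hasCompactSupport_nonneg_nonzero
    (hasCompactSupport_truncPow (by norm_num)) (truncPow_nonneg 2) (x := 0) ?_
  simp [truncPow]

theorem wmean_zero (F : O2 → ℝ) (x : O2) : wmean F x 0 = wmass * F x := by
  simp [wmean, wmass, integral_mul_const]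

/-- Mean value inequality for functions whose Laplacian is bounded below. -/
theorem wmass_mul_le (hF : ContDiff ℝ 2 F) (hFc : HasCompactSupport F) {x : O2} {r S : ℝ}
    (hr : 0 ≤ r) (hS : 0 ≤ S) (h : ∀ z ∈ Metric.closedBall x r, -S ≤ lap F z) :
    wmass * F x ≤ wmean F x r + wmass * (S * r ^ 2 / 12) := by
  set c := ∫ z, truncPow 3 z with hc
  have hcm : c ≤ wmass := integral_mono (integrable_truncPow (by norm_num))
    (integrable_truncPow (by norm_num)) truncPow_three_le
  have hder : ∀ t, HasDerivAt (fun t => wmean F x t + c * (S * t ^ 2 / 12))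
      (t / 6 * ∫ z, truncPow 3 z * (lap F (x + t • z) + S)) t := by
    intro t
    have h1 := (hasDerivAt_wmean hF hFc x t).add
      ((((hasDerivAt_pow 2 t).const_mul S).div_const 12).const_mul c)
    refine h1.congr_deriv ?_
    have h2 : ∫ z, truncPow 3 z * (lap F (x + t • z) + S)
        = (∫ z, truncPow 3 z * lap F (x + t • z)) + c * S := by
      simp only [mul_add]
      rw [integral_add, integral_mul_const]
      · exact integrable_truncPow_mul (by norm_num) ((continuous_lap hF).comp (by fun_prop))
      · exact (integrable_truncPow (by norm_num)).mul_const S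
    rw [h2]; simp; ring
  have hmono : MonotoneOn (fun t => wmean F x t + c * (S * t ^ 2 / 12)) (Set.Icc 0 r) := by
    refine monotoneOn_of_deriv_nonneg (convex_Icc 0 r)
      (fun t _ => (hder t).continuousAt.continuousWithinAt)
      (fun t _ => (hder t).differentiableAt.differentiableWithinAt) fun t ht => ?_
    rw [interior_Icc] at ht
    rw [(hder t).deriv]
    refine mul_nonneg (by linarith [ht.1]) (integral_nonneg fun z => ?_)
    change 0 ≤ truncPow 3 z * (lap F (x + t • z) + S)
    rcases le_or_gt 1 ‖z‖ with hz | hz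
    · rw [truncPow_eq_zero (by norm_num) hz, zero_mul]
    · refine mul_nonneg (truncPow_nonneg _ _) ?_
      have : x + t • z ∈ Metric.closedBall x r := by
        rw [Metric.mem_closedBall, dist_eq_norm, add_sub_cancel_left, norm_smul,
          Real.norm_of_nonneg ht.1.le]
        nlinarith [ht.1, ht.2, norm_nonneg z]
      linarith [h _ this]
  have := hmono (Set.left_mem_Icc.2 hr) (Set.right_mem_Icc.2 hr) hr
  simp only [wmean_zero] at this
  have h5 : c * (S * r ^ 2 / 12) ≤ wmass * (S * r ^ 2 / 12) := by gcongr
  linarith [this, h5, show c * (S * (0 : ℝ) ^ 2 / 12) = 0 by ring]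

theorem wmean_neg (F : O2 → ℝ) (x : O2) (t : ℝ) : wmean (fun z => -F z) x t = -wmean F x t := by
  simp only [wmean, mul_neg, integral_neg]

theorem lap_neg (hF : ContDiff ℝ 2 F) (y : O2) : lap (fun z => -F z) y = -lap F y := by
  have h : ∀ P, dirD (bas P) (dirD (bas P) fun z => -F z) y
      = -dirD (bas P) (dirD (bas P) F) y := fun P => by
    have := dirD_dirD_const_mul hF.contDiffAt (-1) (bas P) (bas P) (y := y)
    simpa using this
  simp [lap, h]

theorem wmean_le (hF : ContDiff ℝ 2 F) (hFc : HasCompactSupport F) {x : O2} {r S : ℝ}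
    (hr : 0 ≤ r) (hS : 0 ≤ S) (h : ∀ z ∈ Metric.closedBall x r, lap F z ≤ S) :
    wmean F x r ≤ wmass * F x + wmass * (S * r ^ 2 / 12) := by
  have := wmass_mul_le (F := fun z => -F z) hF.neg hFc.neg hr hS (x := x) fun z hz => by
    rw [lap_neg hF]; linarith [h z hz]
  rw [wmean_neg] at this
  linarith

/-- Comparison of the mean values of a non-negative function over two balls, the larger of which
contains the smaller with a margin. -/
theorem wmean_le_wmean (hF : Continuous F) (h0 : ∀ z, 0 ≤ F z) {x y : O2} {r : ℝ} (hr : 0 < r)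
    (hxy : ‖y - x‖ ≤ r) : wmean F y r ≤ 2 * 4 ^ 16 * wmean F x (4 * r) := by
  -- the substitution `z = w / 4 + a` maps the ball of radius `r` about `y` into the other ball
  set a : O2 := (4 * r)⁻¹ • (y - x) with ha
  have hna : ‖a‖ ≤ 1 / 4 := by
    rw [ha, norm_smul, norm_inv, Real.norm_of_nonneg (by positivity), inv_mul_le_iff₀ (by positivity)]
    linarith
  set h : O2 → ℝ := fun z => truncPow 2 z * F (x + (4 * r) • z) with hh
  have e1 : ∫ w, h ((1 / 4 : ℝ) • w + a) = 4 ^ 16 * ∫ z, h z := by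
    rw [Measure.integral_comp_smul volume (fun w => h (w + a)) (1 / 4 : ℝ),
      integral_add_right_eq_self h a]
    have : Module.finrank ℝ O2 = 16 := by simp
    rw [this, smul_eq_mul]
    norm_num
  have e2 : ∀ w, h ((1 / 4 : ℝ) • w + a) = truncPow 2 ((1 / 4 : ℝ) • w + a) * F (y + r • w) := by
    intro w
    simp only [hh]
    congr 2
    rw [smul_add, ha, smul_smul, smul_smul, mul_inv_cancel₀ (by positivity), one_smul]
    rw [show 4 * r * (1 / 4) = r by ring]
    abel
  have e3 : ∀ w, truncPow 2 w ≤ 2 * truncPow 2 ((1 / 4 : ℝ) • w + a) := by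
    intro w
    rcases le_or_gt 1 ‖w‖ with hw | hw
    · rw [truncPow_eq_zero (by norm_num) hw]
      exact mul_nonneg (by norm_num) (truncPow_nonneg _ _)
    · have h1 : ‖(1 / 4 : ℝ) • w + a‖ ≤ 1 / 2 := by
        refine (norm_add_le _ _).trans ?_
        rw [norm_smul, Real.norm_of_nonneg (by norm_num)]
        linarith
      have h2 : 3 / 4 ≤ max 0 (1 - ‖(1 / 4 : ℝ) • w + a‖ ^ 2) := by
        refine le_max_of_le_right ?_
        nlinarith [norm_nonneg ((1 / 4 : ℝ) • w + a)]
      have h3 : truncPow 2 w ≤ 1 := pow_le_one₀ (le_max_left _ _) (truncPow_base_le w)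
      have h4 : (3 / 4 : ℝ) ^ 2 ≤ truncPow 2 ((1 / 4 : ℝ) • w + a) := by
        unfold truncPow; gcongr
      linarith
  have hint : Integrable fun w => h ((1 / 4 : ℝ) • w + a) := by
    have : Integrable h := integrable_truncPow_mul (by norm_num) (hF.comp (by fun_prop))
    exact (this.comp_add_right a).comp_smul (by norm_num : (1 / 4 : ℝ) ≠ 0)
  calc wmean F y r ≤ ∫ w, 2 * h ((1 / 4 : ℝ) • w + a) := by
        refine integral_mono (integrable_truncPow_mul (by norm_num) (hF.comp (by fun_prop)))
          (hint.const_mul 2) fun w => ?_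
        simp only [e2]
        nlinarith [h0 (y + r • w), e3 w]
    _ = 2 * 4 ^ 16 * wmean F x (4 * r) := by
        rw [integral_const_mul, e1, wmean]; ring

/-- Harnack inequality for non-negative functions with bounded Laplacian. -/
theorem harnack (hF : ContDiff ℝ 2 F) (hFc : HasCompactSupport F) (h0 : ∀ z, 0 ≤ F z)
    {x y : O2} {r S : ℝ} (hr : 0 < r) (hr1 : r ≤ 1) (hS : 0 ≤ S) (hxy : ‖y - x‖ ≤ r)
    (h : ∀ z ∈ Metric.closedBall x (4 * r), |lap F z| ≤ S) : F y ≤ 4 ^ 20 * (F x + S) := by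
  have h1 := wmass_mul_le hF hFc hr.le hS (x := y) fun z hz => by
    refine (abs_le.1 (h z ?_)).1
    rw [Metric.mem_closedBall] at hz ⊢
    have : dist y x ≤ r := by rwa [dist_eq_norm]
    linarith [dist_triangle z y x]
  have h2 := wmean_le hF hFc (by positivity : 0 ≤ 4 * r) hS (x := x) fun z hz =>
    (abs_le.1 (h z hz)).2
  have h3 := wmean_le_wmean hF.continuous h0 hr hxy
  have hw := wmass_pos
  have hr2 : r ^ 2 ≤ 1 := pow_le_one₀ hr.le hr1
  have hSr : S * r ^ 2 ≤ S := by nlinarith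
  refine le_of_mul_le_mul_left ?_ hw
  have h4 : wmass * (S * r ^ 2) ≤ wmass * S := by gcongr
  have h5 : 0 ≤ wmass * F x := mul_nonneg hw.le (h0 x)
  nlinarith [mul_nonneg hw.le hS]

end MeanValue

/-! ### Invariance of the Laplacian -/

theorem lap_congr {F H : O2 → ℝ} {y : O2} (h : F =ᶠ[𝓝 y] H) : lap F y = lap H y := by
  obtain ⟨Ω, hΩ, ho, hy⟩ := mem_nhds_iff.1 h
  have h' : Set.EqOn F H Ω := fun z hz => hΩ hz
  simp only [lap, dirD_congr ho (dirD_congr ho h' _) _ hy]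

/-- The Laplacian is invariant under affine isometries: they map the standard basis to an
orthonormal basis, and any such basis computes the Laplacian. -/
theorem lap_comp_isometry {H : O2 → ℝ} (g : O2 ≃L[ℝ] O2) (hg : ∀ ξ, ‖g ξ‖ = ‖ξ‖) (v y : O2)
    (hH : ContDiffAt ℝ 2 H (g y + v)) : lap (fun z => H (g z + v)) y = lap H (g y + v) := by
  have haff : ContDiff ℝ 2 fun z => g z + v := g.contDiff.add contDiff_const
  have hcomp : ContDiffAt ℝ 2 (fun z => H (g z + v)) y :=
    ContDiffAt.comp y hH haff.contDiffAt
  have hA : ∀ z, HasFDerivAt (fun z => g z + v) (g : O2 →L[ℝ] O2) z := fun z =>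
    g.hasFDerivAt.add_const v
  have h1 : ∀ w, dirD w (fun z => H (g z + v)) =ᶠ[𝓝 y] fun z => dirD (g w) H (g z + v) := by
    intro w
    have : ∀ᶠ z in 𝓝 y, ContDiffAt ℝ 2 H (g z + v) :=
      haff.continuous.continuousAt.eventually (hH.eventually (by simp))
    filter_upwards [this] with z hz
    have h2 : HasFDerivAt (fun z => H (g z + v)) _ z :=
      (hz.differentiableAt (by norm_num)).hasFDerivAt.comp z (hA z)
    simp [dirD, h2.fderiv]
  have h3 : ∀ w, dirD w (dirD w fun z => H (g z + v)) y
      = fderiv ℝ (fderiv ℝ H) (g y + v) (g w) (g w) := by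
    intro w
    have h4 : DifferentiableAt ℝ (fderiv ℝ H) (g y + v) :=
      (hH.fderiv_right (m := 1) (by norm_num)).differentiableAt (by norm_num)
    have h5 : DifferentiableAt ℝ (dirD (g w) H) (g y + v) :=
      h4.clm_apply (differentiableAt_const _)
    have h6 : HasFDerivAt (fun z => dirD (g w) H (g z + v)) _ y :=
      HasFDerivAt.comp (g := dirD (g w) H) (f := fun z => g z + v) y h5.hasFDerivAt (hA y)
    rw [← dirD_dirD_eq hH, dirD, (h1 w).fderiv_eq, h6.fderiv]
    simp [dirD]
  let gi : O2 ≃ₗᵢ[ℝ] O2 := ⟨g.toLinearEquiv, hg⟩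
  have e1 := congrFun (InnerProductSpace.laplacian_eq_iteratedFDeriv_orthonormalBasis H
    ((EuclideanSpace.basisFun (Fin 2 × Fin 8) ℝ).map gi)) (g y + v)
  have e2 := congrFun (InnerProductSpace.laplacian_eq_iteratedFDeriv_orthonormalBasis H
    (EuclideanSpace.basisFun (Fin 2 × Fin 8) ℝ)) (g y + v)
  rw [e1] at e2
  simp only [iteratedFDeriv_two_apply] at e2
  simp only [lap, h3, dirD_dirD_eq hH]
  simpa [bas, gi] using e2

section Manifold

variable {M : Type*} [TopologicalSpace M] [ChartedSpace O2 M]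

/-- A transition map of a `Spin(9)`-manifold is, locally, an isometry of `ℝ¹⁶`. -/
theorem exists_isometry (hM : IsGAffine Spin9 M) {e e' : OpenPartialHomeomorph M O2}
    (he : e ∈ atlas O2 M) (he' : e' ∈ atlas O2 M) {x : M} (hx : x ∈ e.source)
    (hx' : x ∈ e'.source) :
    ∃ (g : O2 ≃L[ℝ] O2) (v : O2), (∀ ξ, ‖g ξ‖ = ‖ξ‖) ∧ g (e x) + v = e' x ∧
      (∀ᶠ y in 𝓝 (e x), e' (e.symm y) = g y + v) ∧
      ∀ φ : M → ℝ, (fun y => φ (e.symm y)) =ᶠ[𝓝 (e x)] fun y => φ (e'.symm (g y + v)) := by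
  obtain ⟨g, hg, v, h⟩ := hM e he e' he' x ⟨hx, hx'⟩
  refine ⟨g, v, hg.2, ?_, h, fun φ => ?_⟩
  · rw [← h.self_of_nhds, e.left_inv hx]
  · have h1 : ∀ᶠ y in 𝓝 (e x), e.symm y ∈ e'.source := by
      refine (e.continuousAt_symm (e.map_source hx)).eventually_mem ?_
      rw [e.left_inv hx]
      exact e'.open_source.mem_nhds hx'
    filter_upwards [h, h1] with y hy hy1
    rw [← hy, e'.left_inv hy1]

theorem contDiffAt_chart (hM : IsGAffine Spin9 M) {n : WithTop ℕ∞} {φ : M → ℝ} {x : M}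
    (hφ : ContMDiffAt 𝓘(ℝ, O2) 𝓘(ℝ, ℝ) n φ x) {e : OpenPartialHomeomorph M O2}
    (he : e ∈ atlas O2 M) (hx : x ∈ e.source) :
    ContDiffAt ℝ n (fun y => φ (e.symm y)) (e x) := by
  obtain ⟨g, v, -, hgx, -, h⟩ := exists_isometry hM he (chart_mem_atlas O2 x) hx
    (mem_chart_source O2 x)
  have h1 : ContDiffAt ℝ n (fun y => φ ((chartAt O2 x).symm y)) (chartAt O2 x x) := by
    have := (contMDiffAt_iff.1 hφ).2
    simp only [mfld_simps] at this
    exact contDiffWithinAt_univ.1 this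
  refine ContDiffAt.congr_of_eventuallyEq ?_ (h φ)
  rw [← hgx] at h1
  exact ContDiffAt.comp (g := fun y => φ ((chartAt O2 x).symm y)) (e x) h1 ((g.contDiff.add contDiff_const).contDiffAt)

theorem contDiffOn_chart (hM : IsGAffine Spin9 M) {n : WithTop ℕ∞} {φ : M → ℝ} {U : Set M}
    (hU : IsOpen U) (hφ : ContMDiffOn 𝓘(ℝ, O2) 𝓘(ℝ, ℝ) n φ U) {e : OpenPartialHomeomorph M O2}
    (he : e ∈ atlas O2 M) :
    ContDiffOn ℝ n (fun y => φ (e.symm y)) (e.target ∩ e.symm ⁻¹' U) := fun y hy => by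
  have := contDiffAt_chart hM (hφ.contMDiffAt (hU.mem_nhds hy.2)) he (e.map_target hy.1)
  rw [e.right_inv hy.1] at this
  exact this.contDiffWithinAt

/-- The flat Laplacian of a function on `M`, computed in the preferred chart at each point; for a
`Spin(9)`-manifold every chart gives the same value (`lapM_eq`). -/
noncomputable def lapM (φ : M → ℝ) (x : M) : ℝ :=
  lap (fun y => φ ((chartAt O2 x).symm y)) (chartAt O2 x x)

theorem lap_chart_eq (hM : IsGAffine Spin9 M) {φ : M → ℝ} {x : M}
    (hφ : ContMDiffAt 𝓘(ℝ, O2) 𝓘(ℝ, ℝ) 2 φ x) {e e' : OpenPartialHomeomorph M O2}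
    (he : e ∈ atlas O2 M) (hx : x ∈ e.source) (he' : e' ∈ atlas O2 M) (hx' : x ∈ e'.source) :
    lap (fun y => φ (e.symm y)) (e x) = lap (fun y => φ (e'.symm y)) (e' x) := by
  obtain ⟨g, v, hg, hgx, -, h⟩ := exists_isometry hM he he' hx hx'
  rw [lap_congr (h φ)]
  have h1 := contDiffAt_chart hM hφ he' hx'
  rw [← hgx] at h1 ⊢
  exact lap_comp_isometry g hg v (e x) h1

theorem lapM_eq (hM : IsGAffine Spin9 M) {φ : M → ℝ} {x : M}
    (hφ : ContMDiffAt 𝓘(ℝ, O2) 𝓘(ℝ, ℝ) 2 φ x) {e : OpenPartialHomeomorph M O2}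
    (he : e ∈ atlas O2 M) (hx : x ∈ e.source) :
    lapM φ x = lap (fun y => φ (e.symm y)) (e x) :=
  lap_chart_eq hM hφ (chart_mem_atlas O2 x) (mem_chart_source O2 x) he hx

theorem continuousOn_lap {Ω : Set O2} (hΩ : IsOpen Ω) {F : O2 → ℝ} (hF : ContDiffOn ℝ 2 F Ω) :
    ContinuousOn (lap F) Ω :=
  continuousOn_finsetSum _ fun P _ => (contDiffOn_dirD (m := 0) hΩ
    (contDiffOn_dirD (m := 1) hΩ hF (by norm_num) (bas P)) (by norm_num) (bas P)).continuousOn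

theorem contDiffOn_target (hM : IsGAffine Spin9 M) {n : WithTop ℕ∞} {φ : M → ℝ}
    (hφ : ContMDiff 𝓘(ℝ, O2) 𝓘(ℝ, ℝ) n φ) {e : OpenPartialHomeomorph M O2}
    (he : e ∈ atlas O2 M) : ContDiffOn ℝ n (fun y => φ (e.symm y)) e.target := by
  simpa using contDiffOn_chart hM isOpen_univ hφ.contMDiffOn he

/-! ### Local potentials -/

/-- The sum of a section and an octonionic Hessian, in the chart `e`. -/
noncomputable def addHess (G : HermSection M) (φ : M → ℝ) (e : OpenPartialHomeomorph M O2)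
    (x : M) : Mat2 := G.val e x + hessO (fun y => φ (e.symm y)) (e x)

/-- Locally, `G + Hess φ` is the octonionic Hessian of a single function. -/
theorem exists_potential (hM : IsGAffine Spin9 M) {G : HermSection M} (hG : G.HasLocalPotentials)
    {φ : M → ℝ} (hφ : ContMDiff 𝓘(ℝ, O2) 𝓘(ℝ, ℝ) 4 φ) (p : M) :
    ∃ (U : Set M) (u : M → ℝ), IsOpen U ∧ p ∈ U ∧ ContMDiffOn 𝓘(ℝ, O2) 𝓘(ℝ, ℝ) 4 u U ∧
      ∀ e ∈ atlas O2 M, ∀ x ∈ e.source ∩ U,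
        addHess G φ e x = hessO (fun y => u (e.symm y)) (e x) := by
  obtain ⟨U, hU, hp, u, hu, h⟩ := hG p
  have hu4 : ContMDiffOn 𝓘(ℝ, O2) 𝓘(ℝ, ℝ) 4 u U := hu.of_le
    (show ((4 : ℕ∞) : WithTop ℕ∞) ≤ ((⊤ : ℕ∞) : WithTop ℕ∞) from WithTop.coe_le_coe.2 le_top)
  refine ⟨U, fun x => u x + φ x, hU, hp, hu4.add hφ.contMDiffOn, fun e he x hx => ?_⟩
  rw [addHess, h e he x hx, hessO_add]
  · exact (contDiffAt_chart hM (hu4.contMDiffAt (hU.mem_nhds hx.2)) he hx.1).of_le (by norm_num)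
  · exact (contDiffAt_chart hM (hφ x) he hx.1).of_le (by norm_num)

/-- The trace of `G + Hess φ`, computed in the preferred chart at each point. If `G` has local
potentials, every chart gives the same value (`trM_eq`). -/
noncomputable def trM (G : HermSection M) (φ : M → ℝ) (x : M) : ℝ :=
  reTr (addHess G φ (chartAt O2 x) x)

theorem trM_eq_lap (hM : IsGAffine Spin9 M) {G : HermSection M} {φ u : M → ℝ} {U : Set M}
    (hU : IsOpen U) (hu : ContMDiffOn 𝓘(ℝ, O2) 𝓘(ℝ, ℝ) 4 u U)
    (h : ∀ e ∈ atlas O2 M, ∀ x ∈ e.source ∩ U,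
      addHess G φ e x = hessO (fun y => u (e.symm y)) (e x))
    {e : OpenPartialHomeomorph M O2} (he : e ∈ atlas O2 M) {x : M} (hx : x ∈ e.source ∩ U) :
    trM G φ x = lap (fun y => u (e.symm y)) (e x) := by
  rw [trM, h _ (chart_mem_atlas O2 x) x ⟨mem_chart_source O2 x, hx.2⟩, reTr_hessO]
  exact lap_chart_eq hM ((hu.contMDiffAt (hU.mem_nhds hx.2)).of_le (by norm_num))
    (chart_mem_atlas O2 x) (mem_chart_source O2 x) he hx.1

theorem trM_eq (hM : IsGAffine Spin9 M) {G : HermSection M} (hG : G.HasLocalPotentials)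
    {φ : M → ℝ} (hφ : ContMDiff 𝓘(ℝ, O2) 𝓘(ℝ, ℝ) 4 φ) {e : OpenPartialHomeomorph M O2}
    (he : e ∈ atlas O2 M) {x : M} (hx : x ∈ e.source) : trM G φ x = reTr (addHess G φ e x) := by
  obtain ⟨U, u, hU, hp, hu, h⟩ := exists_potential hM hG hφ x
  rw [trM_eq_lap hM hU hu h he ⟨hx, hp⟩, h e he x ⟨hx, hp⟩, reTr_hessO]

theorem continuous_trM (hM : IsGAffine Spin9 M) {G : HermSection M} (hG : G.HasLocalPotentials)
    {φ : M → ℝ} (hφ : ContMDiff 𝓘(ℝ, O2) 𝓘(ℝ, ℝ) 4 φ) : Continuous (trM G φ) := by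
  refine continuous_iff_continuousAt.2 fun p => ?_
  obtain ⟨U, u, hU, hp, hu, h⟩ := exists_potential hM hG hφ p
  set e := chartAt O2 p with he
  have hpe : p ∈ e.source := mem_chart_source O2 p
  have h1 : trM G φ =ᶠ[𝓝 p] fun x => lap (fun y => u (e.symm y)) (e x) := by
    filter_upwards [e.open_source.mem_nhds hpe, hU.mem_nhds hp] with x hx hxU
    exact trM_eq_lap hM hU hu h (chart_mem_atlas O2 p) ⟨hx, hxU⟩
  refine ContinuousAt.congr ?_ h1.symm
  have hΩ : IsOpen (e.target ∩ e.symm ⁻¹' U) := e.isOpen_inter_preimage_symm hU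
  have h2 := continuousOn_lap hΩ
    ((contDiffOn_chart hM hU hu (chart_mem_atlas O2 p)).of_le (by norm_num))
  refine ContinuousAt.comp (g := lap fun y => u (e.symm y)) (h2.continuousAt (hΩ.mem_nhds ⟨e.map_source hpe, ?_⟩))
    (e.continuousAt hpe)
  simpa [e.left_inv hpe] using hp

/-! ### Uniform bounds on a compact manifold -/

/-- On a compact space, a bound that holds locally holds globally. -/
theorem exists_uniform_bound {X : Type*} [TopologicalSpace X] [CompactSpace X]
    {Q : X → ℝ → Prop} (mono : ∀ x C C', C ≤ C' → Q x C → Q x C')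
    (loc : ∀ p, ∃ C, ∀ᶠ x in 𝓝 p, Q x C) : ∃ C, ∀ x, Q x C := by
  have := isCompact_univ.induction_on (p := fun s : Set X => ∃ C, ∀ x ∈ s, Q x C)
    ⟨0, by simp⟩ (fun s t hst ⟨C, hC⟩ => ⟨C, fun x hx => hC x (hst hx)⟩)
    (fun s t ⟨C, hC⟩ ⟨C', hC'⟩ => ⟨max C C', fun x hx => hx.elim
      (fun h => mono _ _ _ (le_max_left _ _) (hC x h))
      (fun h => mono _ _ _ (le_max_right _ _) (hC' x h))⟩)
    (fun p _ => by
      obtain ⟨C, hC⟩ := loc p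
      exact ⟨{x | Q x C}, mem_nhdsWithin_of_mem_nhds hC, C, fun x hx => hx⟩)
  simpa using this

theorem continuousAt_val {G : HermSection M} (hG : G.Smooth) {e : OpenPartialHomeomorph M O2}
    (he : e ∈ atlas O2 M) {x : M} (hx : x ∈ e.source) (i j : Fin 2) (c : Fin 8) :
    ContinuousAt (fun x => (G.val e x i j).coord c) x := by
  have h1 := (hG e he i j c).continuousOn.continuousAt (e.open_target.mem_nhds (e.map_source hx))
  have h2 : ContinuousAt (fun x => (G.val e (e.symm (e x)) i j).coord c) x :=
    ContinuousAt.comp (f := e) h1 (e.continuousAt hx)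
  refine h2.congr ?_
  filter_upwards [e.open_source.mem_nhds hx] with z hz
  rw [e.left_inv hz]

theorem quadForm_le {A : Mat2} (hA : A.IsHermitian) (h : PosDef A) (ξ : O2) :
    quadForm A ξ ≤ 2 * ((A 0 0).re + (A 1 1).re) * ‖ξ‖ ^ 2 := by
  have h1 : 0 ≤ quadForm A (O2.ofCol ![ξ.col 0, -ξ.col 1]) := by
    by_cases h0 : O2.ofCol ![ξ.col 0, -ξ.col 1] = 0
    · rw [h0, quadForm_eq hA]
      simp [O2.col, normSq, dot]
    · exact (h _ h0).le
  obtain ⟨ha, hb, -⟩ := posDef_pos hA h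
  have hx := normSq_nonneg (ξ.col 0)
  have hy := normSq_nonneg (ξ.col 1)
  rw [quadForm_eq hA, col_ofCol] at h1
  rw [quadForm_eq hA, norm_sq_eq]
  have h2 : normSq (-ξ.col 1) = normSq (ξ.col 1) := by simp [normSq]
  have h3 : dot (ξ.col 0) (A 0 1 * -ξ.col 1) = -dot (ξ.col 0) (A 0 1 * ξ.col 1) := by
    rw [mul_neg]; simp [dot]
  simp only [Matrix.cons_val_zero, Matrix.cons_val_one, h2, h3] at h1
  nlinarith [mul_nonneg ha.le hy, mul_nonneg hb.le hx]

/-- A positive section is uniformly positive and bounded, in all charts simultaneously. -/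
theorem exists_quadForm_bound [CompactSpace M] (hM : IsGAffine Spin9 M) {G : HermSection M}
    (hG : G.Smooth) (hpos : G.Positive) :
    ∃ C : ℝ, 0 < C ∧ ∀ e ∈ atlas O2 M, ∀ x ∈ e.source, ∀ ξ,
      C⁻¹ * ‖ξ‖ ^ 2 ≤ quadForm (G.val e x) ξ ∧ quadForm (G.val e x) ξ ≤ C * ‖ξ‖ ^ 2 := by
  have key : ∃ C : ℝ, ∀ x : M, 0 < C ∧ ∀ e ∈ atlas O2 M, x ∈ e.source → ∀ ξ,
      C⁻¹ * ‖ξ‖ ^ 2 ≤ quadForm (G.val e x) ξ ∧ quadForm (G.val e x) ξ ≤ C * ‖ξ‖ ^ 2 := by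
    refine exists_uniform_bound ?_ fun p => ?_
    · rintro x C C' hCC ⟨hC, h⟩
      refine ⟨hC.trans_le hCC, fun e he hx ξ => ⟨le_trans ?_ (h e he hx ξ).1,
        (h e he hx ξ).2.trans ?_⟩⟩ <;> gcongr
    · set e := chartAt O2 p with he'
      have he : e ∈ atlas O2 M := chart_mem_atlas O2 p
      have hp : p ∈ e.source := mem_chart_source O2 p
      set a : M → ℝ := fun x => (G.val e x 0 0).re
      set b : M → ℝ := fun x => (G.val e x 1 1).re
      set d : M → ℝ := fun x => hdet (G.val e x)
      have ca : ContinuousAt a p := continuousAt_val hG he hp 0 0 0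
      have cb : ContinuousAt b p := continuousAt_val hG he hp 1 1 0
      have cd : ContinuousAt d p := by
        refine (ca.mul cb).sub ?_
        exact tendsto_finsetSum _ fun c _ => (continuousAt_val hG he hp 0 1 c).pow 2
      obtain ⟨pa, pb, pd⟩ := posDef_pos (G.isHermitian e he p hp) (hpos e he p hp)
      have hab : 0 < a p + b p := add_pos pa pb
      set m := d p / (a p + b p) / 2 with hm
      have hm0 : 0 < m := by positivity
      set C := max m⁻¹ (2 * (a p + b p + 1)) with hC
      have hC0 : 0 < C := lt_of_lt_of_le (inv_pos.2 hm0) (le_max_left _ _)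
      refine ⟨C, ?_⟩
      have ev1 : ∀ᶠ x in 𝓝 p, m < d x / (a x + b x) :=
        (cd.div (ca.add cb) hab.ne').eventually (lt_mem_nhds (by
          change m < d p / (a p + b p)
          have : 0 < d p / (a p + b p) := by positivity
          rw [hm]; linarith))
      have ev2 : ∀ᶠ x in 𝓝 p, a x + b x < a p + b p + 1 :=
        (ca.add cb).eventually (gt_mem_nhds (by
          change a p + b p < a p + b p + 1
          linarith))
      filter_upwards [ev1, ev2, e.open_source.mem_nhds hp] with x h1 h2 hx
      refine ⟨hC0, fun e' he2 hx' ξ => ?_⟩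
      obtain ⟨g, v, hg, -, htr, -⟩ := exists_isometry hM he2 he hx' hx
      have hfd : fderiv ℝ (fun y => e (e'.symm y)) (e' x) = (g : O2 →L[ℝ] O2) := by
        have h3 : (fun y => e (e'.symm y)) =ᶠ[𝓝 (e' x)] fun y => g y + v := htr
        rw [h3.fderiv_eq]
        exact (g.hasFDerivAt.add_const v).fderiv
      have hcompat := G.compat e' he2 e he x ⟨hx', hx⟩ ξ
      rw [hfd] at hcompat
      rw [← hcompat, ← hg ξ]
      have hA := G.isHermitian e he x hx
      have hP := hpos e he x hx
      constructor
      · refine le_trans ?_ (posDef_quadForm_ge hA hP (g ξ))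
        gcongr
        refine le_trans ?_ h1.le
        exact inv_le_of_inv_le₀ hm0 (le_max_left _ _)
      · refine (quadForm_le hA hP (g ξ)).trans ?_
        gcongr
        refine le_trans ?_ (le_max_right _ _)
        exact mul_le_mul_of_nonneg_left h2.le (by norm_num)
  obtain ⟨C, hC⟩ := key
  rcases isEmpty_or_nonempty M with hE | ⟨⟨x⟩⟩
  · exact ⟨1, one_pos, fun e he x => hE.elim x⟩
  · exact ⟨C, (hC x).1, fun e he x hx => (hC x).2 e he hx⟩

/-! ### The Harnack inequality on the manifold -/

/-- The Harnack inequality with constant `D` for the pair of points `x`, `y`: it is required, in both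
directions, for all non-negative `C²` functions on `M` whose Laplacian is bounded by some `S`, which
enters as an additive error. -/
def HarnackAt (D : ℝ) (x y : M) : Prop :=
  0 ≤ D ∧ ∀ (φ : M → ℝ) (S : ℝ), ContMDiff 𝓘(ℝ, O2) 𝓘(ℝ, ℝ) 2 φ → (∀ z, 0 ≤ φ z) → 0 ≤ S →
    (∀ z, |lapM φ z| ≤ S) → φ y ≤ D * (φ x + S) ∧ φ x ≤ D * (φ y + S)

theorem HarnackAt.symm {D : ℝ} {x y : M} (h : HarnackAt D x y) : HarnackAt D y x :=
  ⟨h.1, fun φ S h1 h2 h3 h4 => (h.2 φ S h1 h2 h3 h4).symm⟩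

theorem HarnackAt.mono {D D' : ℝ} {x y : M} (h : HarnackAt D x y) (hD : D ≤ D') :
    HarnackAt D' x y := by
  refine ⟨h.1.trans hD, fun φ S h1 h2 h3 h4 => ?_⟩
  obtain ⟨ha, hb⟩ := h.2 φ S h1 h2 h3 h4
  have hx := h2 x
  have hy := h2 y
  exact ⟨ha.trans (by gcongr), hb.trans (by gcongr)⟩

theorem HarnackAt.trans {D D' : ℝ} {x y z : M} (h : HarnackAt D x y) (h' : HarnackAt D' y z) :
    HarnackAt (D * D' + D + D') x z := by
  have hD := h.1
  have hD' := h'.1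
  refine ⟨by positivity, fun φ S h1 h2 h3 h4 => ?_⟩
  obtain ⟨ha, hb⟩ := h.2 φ S h1 h2 h3 h4
  obtain ⟨ha', hb'⟩ := h'.2 φ S h1 h2 h3 h4
  have hx := h2 x
  have hz := h2 z
  constructor
  · calc φ z ≤ D' * (φ y + S) := ha'
      _ ≤ D' * (D * (φ x + S) + S) := by gcongr
      _ ≤ _ := by
        have : 0 ≤ D' * φ x + D * (φ x + S) := by positivity
        nlinarith
  · calc φ x ≤ D * (φ y + S) := hb
      _ ≤ D * (D' * (φ z + S) + S) := by gcongr
      _ ≤ _ := by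
        have : 0 ≤ D * φ z + D' * (φ z + S) := by positivity
        nlinarith

/-- The Harnack inequality near a point: a cut-off of the function in a chart is a compactly supported
`C²` function on `ℝ¹⁶`, to which `harnack` applies. -/
theorem harnackAt_local (hM : IsGAffine Spin9 M) (p : M) :
    ∃ U ∈ 𝓝 p, ∀ x ∈ U, ∀ y ∈ U, HarnackAt (4 ^ 20) x y := by
  set e := chartAt O2 p with he'
  have he : e ∈ atlas O2 M := chart_mem_atlas O2 p
  have hp : p ∈ e.source := mem_chart_source O2 p
  obtain ⟨R, hR, hball⟩ := Metric.nhds_basis_closedBall.mem_iff.1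
    (e.open_target.mem_nhds (e.map_source hp))
  set r := min 1 (R / 12) with hr
  have hr0 : 0 < r := by positivity
  have hrR : r ≤ R / 12 := min_le_right _ _
  let χ : ContDiffBump (e p) := ⟨R / 2, R, by positivity, by linarith⟩
  have aux : ∀ x ∈ e.source ∩ e ⁻¹' Metric.ball (e p) (r / 2),
      ∀ y ∈ e.source ∩ e ⁻¹' Metric.ball (e p) (r / 2), ∀ (φ : M → ℝ) (S : ℝ),
      ContMDiff 𝓘(ℝ, O2) 𝓘(ℝ, ℝ) 2 φ → (∀ z, 0 ≤ φ z) → 0 ≤ S →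
      (∀ z, |lapM φ z| ≤ S) → φ y ≤ 4 ^ 20 * (φ x + S) := by
    intro x hx y hy φ S h1 h2 h3 h4
    have hx2 := hx.2
    have hy2 := hy.2
    rw [Set.mem_preimage, Metric.mem_ball] at hx2 hy2
    set F : O2 → ℝ := fun z => χ z * φ (e.symm z) with hF
    have hχ : ∀ z ∈ Metric.ball (e p) (R / 2), F =ᶠ[𝓝 z] fun z => φ (e.symm z) := by
      intro z hz
      filter_upwards [Metric.isOpen_ball.mem_nhds hz] with w hw
      rw [hF]
      simp only
      rw [χ.one_of_mem_closedBall (Metric.ball_subset_closedBall hw), one_mul]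
    have hFd : ContDiff ℝ 2 F := by
      refine contDiff_iff_contDiffAt.2 fun z => ?_
      by_cases hz : z ∈ e.target
      · exact χ.contDiff.contDiffAt.mul
          ((contDiffOn_target hM h1 he).contDiffAt (e.open_target.mem_nhds hz))
      · have hz' : z ∉ tsupport χ := by
          rw [χ.tsupport_eq]
          exact fun h => hz (hball h)
        have h0 : F =ᶠ[𝓝 z] fun _ => 0 := by
          filter_upwards [(isClosed_tsupport χ).isOpen_compl.mem_nhds hz'] with w hw
          rw [hF]
          simp only
          rw [image_eq_zero_of_notMem_tsupport hw, zero_mul]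
        exact contDiffAt_const.congr_of_eventuallyEq h0
    have hFc : HasCompactSupport F := χ.hasCompactSupport.mul_right
    have hval : ∀ w ∈ e.source, dist (e w) (e p) < r / 2 → F (e w) = φ w := by
      intro w hw hd
      exact (hχ (e w) (by rw [Metric.mem_ball]; linarith)).self_of_nhds.trans
        (congrArg φ (e.left_inv hw))
    have := harnack hFd hFc (fun z => mul_nonneg χ.nonneg (h2 _)) (x := e x) (y := e y) hr0
      (min_le_left _ _) h3 (by
        rw [← dist_eq_norm]
        linarith [dist_triangle_right (e y) (e x) (e p)]) (fun z hz => by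
        rw [Metric.mem_closedBall] at hz
        have hzp : dist z (e p) < R / 2 := by linarith [dist_triangle z (e x) (e p)]
        have hzt : z ∈ e.target := hball (by rw [Metric.mem_closedBall]; linarith)
        rw [lap_congr (hχ z hzp)]
        have h5 := lapM_eq hM (h1 (e.symm z)) he (e.map_target hzt)
        rw [e.right_inv hzt] at h5
        rw [← h5]
        exact h4 _)
    rwa [hval x hx.1 hx2, hval y hy.1 hy2] at this
  refine ⟨e.source ∩ e ⁻¹' Metric.ball (e p) (r / 2), ?_, fun x hx y hy => ⟨by positivity,
    fun φ S h1 h2 h3 h4 => ⟨aux x hx y hy φ S h1 h2 h3 h4, aux y hy x hx φ S h1 h2 h3 h4⟩⟩⟩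
  exact (e.isOpen_inter_preimage Metric.isOpen_ball).mem_nhds
    ⟨hp, Metric.mem_ball_self (by positivity)⟩

/-- On a compact connected manifold, the Harnack inequality holds with a uniform constant. -/
theorem exists_harnack [CompactSpace M] [ConnectedSpace M] (hM : IsGAffine Spin9 M) :
    ∃ D : ℝ, ∀ x y : M, HarnackAt D x y := by
  have loc : ∀ p : M, ∀ᶠ y in 𝓝 p, HarnackAt (4 ^ 20) p y := fun p => by
    obtain ⟨U, hU, h⟩ := harnackAt_local hM p
    filter_upwards [hU] with y hy using h p (mem_of_mem_nhds hU) y hy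
  have chain : ∀ x y : M, ∃ D, HarnackAt D x y := by
    intro x y
    have ht : IsTrans M fun x y => ∃ D, HarnackAt D x y :=
      ⟨fun _ _ _ ⟨_, h⟩ ⟨_, h'⟩ => ⟨_, h.trans h'⟩⟩
    have : Std.Symm fun x y : M => ∃ D, HarnackAt D x y := ⟨fun _ _ ⟨_, h⟩ => ⟨_, h.symm⟩⟩
    refine PreconnectedSpace.induction₂ (fun x y => ∃ D, HarnackAt D x y) (fun p => ?_) ht x y
    filter_upwards [loc p] with y hy using ⟨_, hy⟩
  obtain ⟨x₀⟩ := (inferInstance : Nonempty M)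
  obtain ⟨D, hD⟩ := exists_uniform_bound (Q := fun y D => HarnackAt D x₀ y)
    (fun _ _ _ hC h => h.mono hC) fun p => by
      obtain ⟨D, hD⟩ := chain x₀ p
      refine ⟨D * 4 ^ 20 + D + 4 ^ 20, ?_⟩
      filter_upwards [loc p] with y hy using hD.trans hy
  exact ⟨_, fun x y => (hD x).symm.trans (hD y)⟩

end Manifold

/-! ### Pairings of positive matrices -/

theorem polar_mem_Icc {A X : Mat2} (ha : 0 ≤ (A 0 0).re) (hb : 0 ≤ (A 1 1).re)
    (hA : normSq (A 0 1) ≤ (A 0 0).re * (A 1 1).re) (hx : 0 ≤ (X 0 0).re) (hy : 0 ≤ (X 1 1).re)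
    (hX : normSq (X 0 1) ≤ (X 0 0).re * (X 1 1).re) :
    polar A X ∈ Set.Icc 0 (2 * (reTr A * reTr X)) := by
  obtain ⟨h1, h2⟩ := abs_le.1 (two_mul_abs_dot_le ha hb hA hx hy hX)
  rw [reTr_eq, reTr_eq, polar]
  constructor
  · linarith
  · nlinarith [mul_nonneg ha hx, mul_nonneg hb hy, mul_nonneg ha hy, mul_nonneg hb hx]

theorem polar_add (A X Y : Mat2) : polar A (X + Y) = polar A X + polar A Y := by
  simp only [polar, re, dot, Matrix.add_apply, coord_add, mul_add, Finset.sum_add_distrib]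
  ring

theorem polar_eq_mul {A X Y : Mat2} {s : ℝ}
    (h : ∀ i j c, (Y i j).coord c = s * (X i j).coord c) : polar A Y = s * polar A X := by
  have h1 : ∀ c, (A 0 1).coord c * (s * (X 0 1).coord c)
      = s * ((A 0 1).coord c * (X 0 1).coord c) := fun c => by ring
  simp only [polar, re, dot, h, h1, ← Finset.mul_sum]
  ring

theorem diag_pos {A : Mat2} (ht : 0 < reTr A) (hd : 0 < hdet A) :
    0 < (A 0 0).re ∧ 0 < (A 1 1).re := by
  have hN := normSq_nonneg (A 0 1)
  have hdd : hdet A = (A 0 0).re * (A 1 1).re - normSq (A 0 1) := rfl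
  rw [reTr_eq] at ht
  have hab : 0 < (A 0 0).re * (A 1 1).re := by linarith
  rcases pos_and_pos_or_neg_and_neg_of_mul_pos hab with h | h
  · exact h
  · linarith [h.1, h.2]

/-- `Re Tr(B⁻¹ H)` is a polarised determinant. -/
theorem reTr_hinv_mul {B H : Mat2} (hB : B.IsHermitian) (hH : H.IsHermitian) :
    reTr (hinv B * H) = (hdet B)⁻¹ * polar B H := by
  have radd : ∀ x y : Octonion, (x + y).re = x.re + y.re := fun _ _ => rfl
  have rsm : ∀ (c : ℝ) (x : Octonion), (c • x).re = c * x.re := fun _ _ => rfl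
  have rneg : ∀ x : Octonion, (-x).re = -x.re := fun _ => rfl
  have smm : ∀ (c : ℝ) (x y : Octonion), (c • x) * y = c • (x * y) := fun c x y => by
    ext a; fin_cases a <;> simp [mulCoord] <;> ring
  rw [reTr_eq, hinv, polar]
  simp only [Matrix.mul_apply, Fin.sum_univ_two, Matrix.smul_apply, Matrix.of_apply,
    Matrix.cons_val_zero, Matrix.cons_val_one, Matrix.cons_val', Matrix.empty_val',
    Matrix.cons_val_fin_one, smm, rsm, radd, neg_mul, rneg]
  rw [isHermitian_offDiag hB, isHermitian_offDiag hH, isHermitian_diag hB 0,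
    isHermitian_diag hB 1, re_mul_star, re_star_mul]
  have h1 : (1 : Octonion).re = 1 := by simp [re]
  simp only [smul_one_mul, rsm, h1]
  ring

/-! ### The estimate at a maximum point -/

section Manifold

variable {M : Type*} [TopologicalSpace M] [ChartedSpace O2 M]

theorem abs_le_of_ckNorm_le (hM : IsGAffine Spin9 M) {f : M → ℝ}
    (hf : ContMDiff 𝓘(ℝ, O2) 𝓘(ℝ, ℝ) 2 f) {K : ℝ≥0} (h : ckNorm 2 f ≤ K)
    {e : OpenPartialHomeomorph M O2} (he : e ∈ atlas O2 M) {x : M} (hx : x ∈ e.source) :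
    |f x| ≤ K ∧ |lap (fun y => f (e.symm y)) (e x)| ≤ 16 * K := by
  have key : ∀ m ∈ Finset.range 3,
      ‖iteratedFDeriv ℝ m (fun y => f (e.symm y)) (e x)‖ ≤ K := by
    intro m hm
    have h1 : ‖iteratedFDeriv ℝ m (fun y => f (e.symm y)) (e x)‖ₑ ≤ (K : ℝ≥0∞) := by
      refine le_trans ?_ h
      refine le_trans ?_ (Finset.single_le_sum (f := fun m => ⨆ e ∈ atlas O2 M, ⨆ x ∈ e.source,
        ‖iteratedFDeriv ℝ m (fun y => f (e.symm y)) (e x)‖ₑ) (fun _ _ => zero_le) hm)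
      exact le_iSup₂_of_le e he (le_iSup₂_of_le x hx le_rfl)
    have h2 := enorm_le_coe.1 h1
    exact_mod_cast h2
  constructor
  · have := key 0 (by simp)
    rw [norm_iteratedFDeriv_zero, e.left_inv hx] at this
    exact this
  · have h2 := key 2 (by simp)
    have hfx := contDiffAt_chart hM (hf x) he hx
    have h3 : ∀ P, |dirD (bas P) (dirD (bas P) fun y => f (e.symm y)) (e x)| ≤ K := by
      intro P
      rw [dirD_dirD_eq hfx]
      have h4 := (iteratedFDeriv ℝ 2 (fun y => f (e.symm y)) (e x)).le_opNorm ![bas P, bas P]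
      rw [iteratedFDeriv_two_apply] at h4
      simp only [Matrix.cons_val_zero, Matrix.cons_val_one, Fin.prod_univ_two] at h4
      have hb : ‖bas P‖ = 1 := by simp [bas]
      rw [hb, mul_one, mul_one, Real.norm_eq_abs] at h4
      exact h4.trans h2
    calc |lap (fun y => f (e.symm y)) (e x)|
        ≤ ∑ P, |dirD (bas P) (dirD (bas P) fun y => f (e.symm y)) (e x)| :=
          Finset.abs_sum_le_sum_abs _ _
      _ ≤ ∑ _P : Fin 2 × Fin 8, (K : ℝ) := Finset.sum_le_sum fun P _ => h3 P
      _ = 16 * K := by simp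

theorem contDiffOn_log_hdet {G : HermSection M} (hG : G.Smooth) (hpos : G.Positive)
    {e : OpenPartialHomeomorph M O2} (he : e ∈ atlas O2 M) :
    ContDiffOn ℝ 2 (fun y => Real.log (hdet (G.val e (e.symm y)))) e.target := by
  have h2 : ∀ i j a, ContDiffOn ℝ 2 (fun y => (G.val e (e.symm y) i j).coord a) e.target :=
    fun i j a => (hG e he i j a).of_le
      (show ((2 : ℕ∞) : WithTop ℕ∞) ≤ ((⊤ : ℕ∞) : WithTop ℕ∞) from WithTop.coe_le_coe.2 le_top)
  refine ContDiffOn.log ?_ fun y hy => ?_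
  · exact ((h2 0 0 0).mul (h2 1 1 0)).sub (ContDiffOn.sum fun c _ => (h2 0 1 c).pow 2)
  · have hx := e.map_target hy
    exact (posDef_pos (G.isHermitian e he _ hx) (hpos e he _ hx)).2.2.ne'

/-- On a compact manifold every point lies in a chart in which `Δ log det G` is at least `-L`. -/
theorem exists_lap_log_hdet_ge [CompactSpace M] {G : HermSection M} (hG : G.Smooth)
    (hpos : G.Positive) : ∃ L : ℝ, ∀ x : M, ∃ e ∈ atlas O2 M, x ∈ e.source ∧
      -L ≤ lap (fun y => Real.log (hdet (G.val e (e.symm y)))) (e x) := by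
  refine exists_uniform_bound ?_ fun p => ?_
  · rintro x C C' hCC ⟨e, he, hx, h⟩
    exact ⟨e, he, hx, by linarith⟩
  · set e := chartAt O2 p with he'
    have he : e ∈ atlas O2 M := chart_mem_atlas O2 p
    have hp : p ∈ e.source := mem_chart_source O2 p
    set H : O2 → ℝ := lap fun y => Real.log (hdet (G.val e (e.symm y))) with hH
    have hc : ContinuousAt (fun x => H (e x)) p := by
      have h1 : ContinuousOn H e.target :=
        continuousOn_lap e.open_target (contDiffOn_log_hdet hG hpos he)
      exact ContinuousAt.comp (g := H) (h1.continuousAt (e.open_target.mem_nhds (e.map_source hp)))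
        (e.continuousAt hp)
    refine ⟨1 - H (e p), ?_⟩
    filter_upwards [hc.eventually (lt_mem_nhds (show H (e p) - 1 < H (e p) by linarith)),
      e.open_source.mem_nhds hp] with x hx hxs
    exact ⟨e, he, hxs, by linarith⟩

theorem hdet_addHess_pos {G₀ : HermSection M} (hpos : G₀.Positive) {f φ : M → ℝ}
    (heq : SolvesMA G₀ f φ) {e : OpenPartialHomeomorph M O2} (he : e ∈ atlas O2 M) {x : M}
    (hx : x ∈ e.source) : 0 < hdet (addHess G₀ φ e x) := by
  rw [addHess, heq e he x hx]
  exact mul_pos (Real.exp_pos _) (posDef_pos (G₀.isHermitian e he x hx) (hpos e he x hx)).2.2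

theorem reTr_add (A B : Mat2) : reTr (A + B) = reTr A + reTr B := by
  simp only [reTr_eq, Matrix.add_apply, re, coord_add]; ring

theorem trM_eq_add (hM : IsGAffine Spin9 M) {G₀ : HermSection M} (hpot : G₀.HasLocalPotentials)
    {φ : M → ℝ} (hφ : ContMDiff 𝓘(ℝ, O2) 𝓘(ℝ, ℝ) 4 φ) {e : OpenPartialHomeomorph M O2}
    (he : e ∈ atlas O2 M) {x : M} (hx : x ∈ e.source) :
    trM G₀ φ x = reTr (G₀.val e x) + lapM φ x := by
  rw [trM_eq hM hpot hφ he hx, addHess, reTr_add, reTr_hessO,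
    lapM_eq hM ((hφ x).of_le (by norm_num)) he hx]

theorem lap_nonneg_of_isLocalMin {F : O2 → ℝ} {y : O2} (hF : ContDiffAt ℝ 2 F y)
    (hmin : IsLocalMin F y) : 0 ≤ lap F y := by
  refine Finset.sum_nonneg fun P _ => ?_
  have h1 := dirD_dirD_const_mul hF (-1) (bas P) (bas P)
  have h2 := dirD_dirD_nonpos (F := fun z => -1 * F z) (contDiffAt_const.mul hF)
    (by simpa using hmin.neg) (bas P)
  linarith

/-- The trace of `G₀ + Hess φ` is positive for every solution: it is positive where `φ` attains its
minimum, and it has no zeros because the determinant is positive. -/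
theorem trM_pos [CompactSpace M] [ConnectedSpace M] (hM : IsGAffine Spin9 M) {G₀ : HermSection M}
    (hpos : G₀.Positive) (hpot : G₀.HasLocalPotentials) {f φ : M → ℝ}
    (hφ : ContMDiff 𝓘(ℝ, O2) 𝓘(ℝ, ℝ) 4 φ) (heq : SolvesMA G₀ f φ) (x : M) : 0 < trM G₀ φ x := by
  have hne : ∀ x, trM G₀ φ x ≠ 0 := by
    intro x h0
    have hd := hdet_addHess_pos hpos heq (chart_mem_atlas O2 x) (mem_chart_source O2 x)
    set A := addHess G₀ φ (chartAt O2 x) x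
    have h1 : (A 0 0).re + (A 1 1).re = 0 := by rw [← reTr_eq]; exact h0
    have hN := normSq_nonneg (A 0 1)
    have hdd : hdet A = (A 0 0).re * (A 1 1).re - normSq (A 0 1) := rfl
    rw [eq_neg_of_add_eq_zero_right h1] at hdd
    nlinarith [sq_nonneg (A 0 0).re]
  obtain ⟨p, -, hp⟩ := isCompact_univ.exists_isMinOn Set.univ_nonempty
    (hφ.continuous.continuousOn (s := Set.univ))
  have hp' : 0 < trM G₀ φ p := by
    set e := chartAt O2 p with he'
    have he : e ∈ atlas O2 M := chart_mem_atlas O2 p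
    have hps : p ∈ e.source := mem_chart_source O2 p
    rw [trM_eq_add hM hpot hφ he hps]
    obtain ⟨ha, hb, -⟩ := posDef_pos (G₀.isHermitian e he p hps) (hpos e he p hps)
    have : 0 ≤ lapM φ p := by
      rw [lapM_eq hM ((hφ p).of_le (by norm_num)) he hps]
      refine lap_nonneg_of_isLocalMin
        ((contDiffAt_chart hM (hφ p) he hps).of_le (by norm_num)) ?_
      refine Filter.Eventually.of_forall fun z => ?_
      simp only [e.left_inv hps]
      exact hp (Set.mem_univ _)
    rw [reTr_eq]; linarith
  by_contra! hx
  obtain ⟨z, hz⟩ := mem_range_of_exists_le_of_exists_ge (continuous_trM hM hpot hφ)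
    ⟨x, hx⟩ ⟨p, hp'.le⟩
  exact hne z hz

/-- The maximum principle for `T - s φ`, where `T = tr(G₀ + Hess φ)`: at a maximum point
`exp ψ · Δψ ≤ polar G (Hess T) ≤ s · polar G (Hess φ) = s (2 hdet G - polar G G₀)`, and
`polar G G₀ ≥ T / C`. -/
theorem trM_le_of_isMax [CompactSpace M] [ConnectedSpace M] (hM : IsGAffine Spin9 M)
    {G₀ : HermSection M} (hG : G₀.Smooth) (hpos : G₀.Positive) (hpot : G₀.HasLocalPotentials)
    {C L : ℝ} (hC : 0 < C)
    (hbound : ∀ e ∈ atlas O2 M, ∀ x ∈ e.source, ∀ ξ,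
      C⁻¹ * ‖ξ‖ ^ 2 ≤ quadForm (G₀.val e x) ξ ∧ quadForm (G₀.val e x) ξ ≤ C * ‖ξ‖ ^ 2)
    {e : OpenPartialHomeomorph M O2} (he : e ∈ atlas O2 M) {x : M} (hx : x ∈ e.source)
    (hL : -L ≤ lap (fun y => Real.log (hdet (G₀.val e (e.symm y)))) (e x)) (hL0 : 0 ≤ L)
    {f φ : M → ℝ} (hf : ContMDiff 𝓘(ℝ, O2) 𝓘(ℝ, ℝ) 2 f) (hφ : ContMDiff 𝓘(ℝ, O2) 𝓘(ℝ, ℝ) 4 φ)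
    (heq : SolvesMA G₀ f φ) {K : ℝ≥0} (hK : ckNorm 2 f ≤ K) {s : ℝ} (hs : 0 < s)
    (hmax : ∀ z, trM G₀ φ z - s * φ z ≤ trM G₀ φ x - s * φ x) :
    trM G₀ φ x ≤ C * (Real.exp K * C ^ 2 * (2 + (16 * K + L) / s)) := by
  obtain ⟨U, u, hU, hxU, hu, hpotU⟩ := exists_potential hM hpot hφ x
  set Ω := e.target ∩ e.symm ⁻¹' U with hΩdef
  have hΩ : IsOpen Ω := e.isOpen_inter_preimage_symm hU
  have hxΩ : e x ∈ Ω := ⟨e.map_source hx, by simpa [e.left_inv hx] using hxU⟩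
  set F : O2 → ℝ := fun y => u (e.symm y) with hFdef
  have hF : ContDiffOn ℝ 4 F Ω := contDiffOn_chart hM hU hu he
  set l : O2 → ℝ := fun y => Real.log (hdet (G₀.val e (e.symm y))) with hldef
  have hl : ContDiffOn ℝ 2 l Ω := (contDiffOn_log_hdet hG hpos he).mono Set.inter_subset_left
  set f' : O2 → ℝ := fun y => f (e.symm y) with hfdef
  have hf' : ContDiffOn ℝ 2 f' Ω := (contDiffOn_target hM hf he).mono Set.inter_subset_left
  set φ' : O2 → ℝ := fun y => φ (e.symm y) with hφdef
  have hφ' : ContDiffOn ℝ 4 φ' Ω := (contDiffOn_target hM hφ he).mono Set.inter_subset_left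
  have hdetG : ∀ z ∈ e.source, 0 < hdet (G₀.val e z) := fun z hz =>
    (posDef_pos (G₀.isHermitian e he z hz) (hpos e he z hz)).2.2
  have hMA : ∀ z ∈ Ω, hdet (hessO F z) = Real.exp (f' z + l z) := by
    intro z hz
    have hzs := e.map_target hz.1
    have h1 := hpotU e he (e.symm z) ⟨hzs, hz.2⟩
    rw [e.right_inv hz.1] at h1
    have h2 := heq e he (e.symm z) hzs
    rw [← addHess, h1] at h2
    rw [h2, Real.exp_add, Real.exp_log (hdetG _ hzs)]
  have hAeq : addHess G₀ φ e x = hessO F (e x) := hpotU e he x ⟨hx, hxU⟩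
  have hdA := hdet_addHess_pos hpos heq he hx
  have htr : trM G₀ φ x = reTr (addHess G₀ φ e x) := trM_eq hM hpot hφ he hx
  have htpos := trM_pos hM hpos hpot hφ heq x
  obtain ⟨hA0, hA1⟩ := diag_pos (by rwa [htr] at htpos) hdA
  have h1 := polar_hessO_lap_ge hΩ hF (hf'.add hl) hMA hxΩ (by rwa [← hAeq])
  -- the function with a local maximum at the given point
  have hlapF : ContDiffAt ℝ 2 (lap F) (e x) :=
    (contDiffOn_lap hΩ hF).contDiffAt (hΩ.mem_nhds hxΩ)
  have hφx : ContDiffAt ℝ 2 φ' (e x) :=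
    (hφ'.contDiffAt (hΩ.mem_nhds hxΩ)).of_le (by norm_num)
  have hφs : ContDiffAt ℝ 2 (fun z => -s * φ' z) (e x) := contDiffAt_const.mul hφx
  have hlm : IsLocalMax (fun z => lap F z + -s * φ' z) (e x) := by
    filter_upwards [hΩ.mem_nhds hxΩ] with z hz
    have e1 : ∀ z ∈ Ω, trM G₀ φ (e.symm z) = lap F z := fun z hz => by
      rw [trM_eq_lap hM hU hu hpotU he ⟨e.map_target hz.1, hz.2⟩, e.right_inv hz.1]
    have h2 := hmax (e.symm z)
    rw [e1 z hz, ← e.left_inv hx, e1 _ hxΩ, e.left_inv hx] at h2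
    have h3 : φ' (e x) = φ x := congrArg φ (e.left_inv hx)
    rw [h3]
    change lap F z + -s * φ (e.symm z) ≤ _
    linarith
  have h2 := polar_hessO_nonpos (A := addHess G₀ φ e x) hA0 hdA (hlapF.add hφs) hlm
  have h3 : hessO (fun z => lap F z + -s * φ' z) (e x)
      = hessO (lap F) (e x) + hessO (fun z => -s * φ' z) (e x) := hessO_add hlapF hφs
  have h4 : polar (addHess G₀ φ e x) (hessO (lap F) (e x))
      + -s * polar (addHess G₀ φ e x) (hessO φ' (e x)) ≤ 0 := by
    rw [← polar_eq_mul (hessO_const_mul hφx (-s)), ← polar_add, ← h3]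
    exact h2
  -- `Hess φ` is the difference of the two metrics
  have h5 : polar (addHess G₀ φ e x) (hessO φ' (e x))
      = 2 * hdet (addHess G₀ φ e x) - polar (addHess G₀ φ e x) (G₀.val e x) := by
    have : polar (addHess G₀ φ e x) (addHess G₀ φ e x)
        = polar (addHess G₀ φ e x) (G₀.val e x) + polar (addHess G₀ φ e x) (hessO φ' (e x)) :=
      polar_add _ _ _
    rw [hdet_eq_polar, this]; ring
  obtain ⟨b1, b2, b3⟩ := le_of_forall_quadForm_ge (G₀.isHermitian e he x hx)
    fun ξ => (hbound e he x hx ξ).1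
  have h6 := polar_ge hA0 hdA b1 b2 b3
  rw [← reTr_eq, ← htr] at h6
  obtain ⟨hf0, hf2⟩ := abs_le_of_ckNorm_le hM hf hK he hx
  have hlap : lap (fun z => f' z + l z) (e x) = lap f' (e x) + lap l (e x) := by
    simp only [lap, dirD_dirD_add (hf'.contDiffAt (hΩ.mem_nhds hxΩ))
      (hl.contDiffAt (hΩ.mem_nhds hxΩ)), Finset.sum_add_distrib]
  have hlow : -(16 * K + L) ≤ lap (fun z => f' z + l z) (e x) := by
    rw [hlap]; linarith [(abs_le.1 hf2).1]
  rw [← hAeq] at h1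
  have hexp : Real.exp (f' (e x) + l (e x)) = hdet (addHess G₀ φ e x) := by
    rw [hAeq, hMA _ hxΩ]
  change Real.exp (f' (e x) + l (e x)) * lap (fun z => f' z + l z) (e x) ≤ _ at h1
  rw [hexp] at h1
  -- the determinant is bounded
  have hdet_le : hdet (addHess G₀ φ e x) ≤ Real.exp K * C ^ 2 := by
    rw [addHess, heq e he x hx]
    have g1 := diag_le_of_forall_quadForm_le (G₀.isHermitian e he x hx)
      fun ξ => (hbound e he x hx ξ).2
    have hN := normSq_nonneg (G₀.val e x 0 1)
    have hCi : 0 < C⁻¹ := inv_pos.2 hC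
    have : hdet (G₀.val e x) ≤ C ^ 2 := by
      rw [hdet]
      nlinarith [mul_le_mul g1.1 g1.2 (hCi.le.trans b2) hC.le]
    have hfK : f x ≤ K := (abs_le.1 hf0).2
    have := (hdetG x hx).le
    gcongr
  set T := trM G₀ φ x
  set E := hdet (addHess G₀ φ e x)
  set Q := polar (addHess G₀ φ e x) (G₀.val e x)
  set lp := lap (fun z => f' z + l z) (e x)
  rw [h5] at h4
  have hKL : 0 ≤ 16 * (K : ℝ) + L := by positivity
  have h7 : s * (C⁻¹ * T) ≤ E * (2 * s + (16 * K + L)) := by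
    have : -(E * (16 * K + L)) ≤ E * lp := by nlinarith
    have := mul_le_mul_of_nonneg_left h6 hs.le
    linarith
  have h8 : C⁻¹ * T ≤ E * (2 + (16 * K + L) / s) := by
    refine le_of_mul_le_mul_left ?_ hs
    calc s * (C⁻¹ * T) ≤ E * (2 * s + (16 * K + L)) := h7
      _ = s * (E * (2 + (16 * K + L) / s)) := by field_simp
  have h9 : C⁻¹ * T ≤ Real.exp K * C ^ 2 * (2 + (16 * K + L) / s) :=
    h8.trans (by gcongr)
  rwa [inv_mul_le_iff₀ hC] at h9

theorem lapM_sub_const (φ : M → ℝ) (c : ℝ) : lapM (fun x => φ x - c) = lapM φ := by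
  funext x
  have h : ∀ (F : O2 → ℝ) (v : O2), dirD v (fun z => F z - c) = dirD v F := fun F v => by
    funext z; simp only [dirD, fderiv_sub_const]
  simp only [lapM, lap, h]

theorem reTr_val_mem_Icc {G : HermSection M} {C : ℝ} (hC : 0 < C)
    {e : OpenPartialHomeomorph M O2} (he : e ∈ atlas O2 M) {x : M} (hx : x ∈ e.source)
    (hbound : ∀ ξ, C⁻¹ * ‖ξ‖ ^ 2 ≤ quadForm (G.val e x) ξ ∧
      quadForm (G.val e x) ξ ≤ C * ‖ξ‖ ^ 2) : reTr (G.val e x) ∈ Set.Icc 0 (2 * C) := by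
  have hCi : 0 < C⁻¹ := inv_pos.2 hC
  obtain ⟨b1, b2, -⟩ := le_of_forall_quadForm_ge (G.isHermitian e he x hx) fun ξ => (hbound ξ).1
  obtain ⟨q0, q1⟩ := diag_le_of_forall_quadForm_le (G.isHermitian e he x hx)
    fun ξ => (hbound ξ).2
  rw [reTr_eq]
  constructor <;> linarith

end Manifold

end OctMA

/-! ### The Laplacian estimate -/

open OctMA

theorem theoremT {M : Type*} [TopologicalSpace M] [ChartedSpace O2 M]
    [T2Space M] [CompactSpace M] [ConnectedSpace M]
    (hM : IsGAffine Spin9 M)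
    (G₀₀ : HermSection M) (hG₀₀ : G₀₀.Smooth) (hG₀₀pos : G₀₀.Positive) (hG₀₀par : G₀₀.Parallel)
    (G₀ : HermSection M) (hG₀ : G₀.Smooth) (hG₀pos : G₀.Positive)
    (hG₀pot : G₀.HasLocalPotentials) (K : ℝ≥0) :
    ∃ C : ℝ, ∀ f φ : M → ℝ,
      ContMDiff 𝓘(ℝ, O2) 𝓘(ℝ, ℝ) 2 f → ContMDiff 𝓘(ℝ, O2) 𝓘(ℝ, ℝ) 4 φ →
      SolvesMA G₀ f φ → ckNorm 2 f ≤ K →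
      ∀ e ∈ atlas O2 M, ∀ x ∈ e.source, |laplacian G₀₀ φ e x| ≤ C := by
  obtain ⟨C, hC, hbound⟩ := exists_quadForm_bound hM hG₀ hG₀pos
  obtain ⟨C', hC', hbound'⟩ := exists_quadForm_bound hM hG₀₀ hG₀₀pos
  obtain ⟨L, hL⟩ := exists_lap_log_hdet_ge hG₀ hG₀pos
  obtain ⟨D₀, hD₀⟩ := exists_harnack hM
  set D := max D₀ 1 with hDdef
  have hD : ∀ x y : M, HarnackAt D x y := fun x y => (hD₀ x y).mono (le_max_left _ _)
  have hDpos : 0 < D := lt_of_lt_of_le one_pos (le_max_right _ _)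
  -- the choice of `s` makes the linear Harnack bound absorbable
  set s := (2 * D)⁻¹ with hsdef
  have hs : 0 < s := by positivity
  set B := C * (Real.exp K * C ^ 2 * (2 + (16 * K + max L 0) / s)) with hB
  refine ⟨C' ^ 2 * (2 * (2 * C' * (2 * B + 4 * C))), fun f φ hf hφ heq hK e he x hx => ?_⟩
  have hcT := continuous_trM hM hG₀pot hφ
  have hTpos := trM_pos hM hG₀pos hG₀pot hφ heq
  obtain ⟨xm, -, hxm⟩ := isCompact_univ.exists_isMaxOn Set.univ_nonempty
    (hcT.continuousOn (s := Set.univ))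
  obtain ⟨x₀, -, hx₀⟩ := isCompact_univ.exists_isMaxOn Set.univ_nonempty
    ((hcT.sub (continuous_const.mul hφ.continuous)).continuousOn
      (f := fun z => trM G₀ φ z - s * φ z) (s := Set.univ))
  obtain ⟨xn, -, hxn⟩ := isCompact_univ.exists_isMinOn Set.univ_nonempty
    (hφ.continuous.continuousOn (s := Set.univ))
  have hmax : ∀ z, trM G₀ φ z ≤ trM G₀ φ xm := fun z => hxm (Set.mem_univ z)
  have hmax₀ : ∀ z, trM G₀ φ z - s * φ z ≤ trM G₀ φ x₀ - s * φ x₀ := fun z =>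
    hx₀ (Set.mem_univ z)
  have hmin : ∀ z, φ xn ≤ φ z := fun z => hxn (Set.mem_univ z)
  set S := trM G₀ φ xm with hS
  have hSpos : 0 < S := hTpos xm
  have hlap : ∀ z, |lapM φ z| ≤ S + 2 * C := by
    intro z
    have h1 := trM_eq_add hM hG₀pot hφ (chart_mem_atlas O2 z) (mem_chart_source O2 z)
    have h2 := reTr_val_mem_Icc hC (chart_mem_atlas O2 z) (mem_chart_source O2 z)
      (hbound _ (chart_mem_atlas O2 z) z (mem_chart_source O2 z))
    have h3 := hTpos z
    have h4 := hmax z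
    rw [abs_le]
    constructor <;> linarith [h2.1, h2.2]
  have hosc : ∀ y, φ y - φ xn ≤ D * (S + 2 * C) := by
    intro y
    have hφ2 : ContMDiff 𝓘(ℝ, O2) 𝓘(ℝ, ℝ) 2 φ := hφ.of_le (by norm_num)
    have h1 := ((hD xn y).2 (fun z => φ z - φ xn) (S + 2 * C) (hφ2.sub contMDiff_const)
      (fun z => sub_nonneg.2 (hmin z)) (by positivity)
      (fun z => by rw [lapM_sub_const]; exact hlap z)).1
    simpa using h1
  obtain ⟨e₀, he₀, hx₀s, hL₀⟩ := hL x₀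
  have hTx₀ : trM G₀ φ x₀ ≤ B := trM_le_of_isMax hM hG₀ hG₀pos hG₀pot hC hbound he₀ hx₀s
    (by linarith [le_max_left L 0]) (le_max_right L 0) hf hφ heq hK hs hmax₀
  have hSle : S ≤ 2 * B + 2 * C := by
    have h1 := hmax₀ xm
    have h2 := hosc xm
    have h3 := hmin x₀
    have h4 : s * (φ xm - φ x₀) ≤ s * (D * (S + 2 * C)) := by gcongr; linarith
    have h5 : s * (D * (S + 2 * C)) = (S + 2 * C) / 2 := by
      rw [hsdef]; field_simp
    linarith
  -- the bound for the Laplacian with respect to the parallel metric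
  have hφx := (contDiffAt_chart hM (hφ x) he hx).of_le (show (2 : WithTop ℕ∞) ≤ 4 by norm_num)
  set A := addHess G₀ φ e x with hA
  have hdA : 0 < hdet A := hdet_addHess_pos hG₀pos heq he hx
  have htr : trM G₀ φ x = reTr A := trM_eq hM hG₀pot hφ he hx
  obtain ⟨hA0, hA1⟩ := diag_pos (by rw [← htr]; exact hTpos x) hdA
  have hH00 := G₀₀.isHermitian e he x hx
  obtain ⟨c1, c2, c3⟩ := le_of_forall_quadForm_ge hH00 fun ξ => (hbound' e he x hx ξ).1
  obtain ⟨p1, p2, p3⟩ := posDef_pos hH00 (hG₀₀pos e he x hx)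
  obtain ⟨r1, r2, r3⟩ := posDef_pos (G₀.isHermitian e he x hx) (hG₀pos e he x hx)
  have t1 := reTr_val_mem_Icc hC he hx (hbound e he x hx)
  have t2 := reTr_val_mem_Icc hC' he hx (hbound' e he x hx)
  have hdetB : (hdet (G₀₀.val e x))⁻¹ ≤ C' ^ 2 := by
    have hCi : 0 < C'⁻¹ := inv_pos.2 hC'
    have : C'⁻¹ ^ 2 ≤ hdet (G₀₀.val e x) := by
      rw [hdet]; nlinarith
    rw [inv_le_comm₀ p3 (by positivity), ← inv_pow]
    exact this
  have hpA := polar_mem_Icc (A := G₀₀.val e x) (X := A) p1.le p2.le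
    (by have := p3.le; rw [hdet] at this; linarith) hA0.le hA1.le
    (by have := hdA.le; rw [hdet] at this; linarith)
  have hpG := polar_mem_Icc (A := G₀₀.val e x) (X := G₀.val e x) p1.le p2.le
    (by have := p3.le; rw [hdet] at this; linarith) r1.le r2.le
    (by have := r3.le; rw [hdet] at this; linarith)
  have hsplit : polar (G₀₀.val e x) A = polar (G₀₀.val e x) (G₀.val e x)
      + polar (G₀₀.val e x) (hessO (fun y => φ (e.symm y)) (e x)) := polar_add _ _ _
  have hTx : reTr A ≤ 2 * B + 2 * C := by rw [← htr]; exact (hmax x).trans hSle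
  have hTx0 : 0 < reTr A := by rw [← htr]; exact hTpos x
  have hB0 : 0 ≤ B := (hTpos x₀).le.trans hTx₀
  have u1 : reTr (G₀₀.val e x) * reTr A ≤ 2 * C' * (2 * B + 4 * C) :=
    mul_le_mul t2.2 (by linarith) hTx0.le (by positivity)
  have u2 : reTr (G₀₀.val e x) * reTr (G₀.val e x) ≤ 2 * C' * (2 * B + 4 * C) :=
    mul_le_mul t2.2 (by linarith [t1.2]) t1.1 (by positivity)
  have hpol : |polar (G₀₀.val e x) (hessO (fun y => φ (e.symm y)) (e x))|
      ≤ 2 * (2 * C' * (2 * B + 4 * C)) := by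
    rw [abs_le]
    constructor <;> linarith [hpA.1, hpA.2, hpG.1, hpG.2]
  rw [laplacian, reTr_hinv_mul hH00 (hessO_isHermitian hφx), abs_mul,
    abs_of_pos (inv_pos.2 p3)]
  exact mul_le_mul hdetB hpol (abs_nonneg _) (by positivity)
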